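/- Let $\mathcal L=\mathbb Z\times\mathbb Z$. For a set $C\subset\mathbb R^2$ let the discrete hull $C^0$ be the convex hull of $C\cap\mathcal L$, let $|C^0|$ denote the number of its vertices, and let $\delta(C)$ be the (Euclidean) diameter of $C$. Model of computation: a real-number machine whose registers each hold one real number, which performs the operations $+,-,\times,/$, floor and comparisons in one step each, with integer constants. The set $C$ is accessible only through line queries: in one step, for a query line $\ell$ (given by a point and a nonzero direction), the machine is told that $\ell\cap C=\emptyset$ or receives the two end points, in unspecified order and possibly equal, of the segment $\ell\cap C$. Output is written to a write-only list, which does not count as space. Theorem. There are a single program, which uses a fixed finite number of registers (that is, $O(1)$ space), and an absolute constant $K$ such that the following holds for every compact convex set $C\subset\mathbb R^2$ and every vertex $v_0$ of $C^0$. Given the coordinates of $v_0$ and line queries to $C$, the program halts after at most $K\,|C^0|\log(2+\delta(C))$ steps (hence in $O(|C^0|\log\delta(C))$ time whenever $\delta(C)\ge 2$), having output the vertices of $C^0$, each exactly once, in counterclockwise order starting from $v_0$. -/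

import Mathlib

namespace DiscreteHull

/-- The Euclidean plane. -/
abbrev Plane : Type := EuclideanSpace ℝ (Fin 2)

/-- The integer lattice in the plane. -/
def lattice : Set Plane := {x | ∀ i, ∃ n : ℤ, x i = n}

/-- The discrete hull of `C`: the convex hull of the lattice points of `C`. -/
def discreteHull (C : Set Plane) : Set Plane := convexHull ℝ (C ∩ lattice)

/-- The set of vertices of the discrete hull. -/
def hullVertices (C : Set Plane) : Set Plane := (discreteHull C).extremePoints ℝ

/-- The planar cross product; it is nonnegative iff `v` does not lie to the right of `u`. -/
def cross (u v : Plane) : ℝ := u 0 * v 1 - u 1 * v 0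

/-- The line through `p` with direction `d` (a genuine line when `d ≠ 0`). -/
def lineAt (p d : Plane) : Set Plane := {x | ∃ t : ℝ, x = p + t • d}

/-- A device that answers line queries. The query is a point and a direction; the answer is
either `none` or a pair of points. -/
abbrev LineOracle : Type := Plane → Plane → Option (Plane × Plane)

/-- The device answers every line query on `C` correctly: it reports that the line misses `C`, or
it returns the two end points (in no particular order, possibly equal) of the segment in which the
line meets `C`. Nothing is said about queries with direction zero. -/
def LineOracle.Answers (O : LineOracle) (C : Set Plane) : Prop :=
  ∀ p d : Plane, d ≠ 0 →
    match O p d with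
    | none => C ∩ lineAt p d = ∅
    | some (a, b) => C ∩ lineAt p d = segment ℝ a b

/-! ### A real-number machine with `R` registers, the floor function and line queries

The memory consists of `R` registers, each of which holds one real number; `R` belongs to the
program, so a program uses a constant amount of space. Results are written to a write-only
output list. -/

/-- The contents of the registers. -/
abbrev Store (R : ℕ) : Type := Fin R → ℝ

/-- Arithmetic terms over the registers; the only constants are integers. -/
inductive ArithTerm (R : ℕ) : Type
  | const (n : ℤ) : ArithTerm R
  | reg (i : Fin R) : ArithTerm R
  | add (e f : ArithTerm R) : ArithTerm R
  | sub (e f : ArithTerm R) : ArithTerm R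
  | mul (e f : ArithTerm R) : ArithTerm R
  | div (e f : ArithTerm R) : ArithTerm R
  | floor (e : ArithTerm R) : ArithTerm R

/-- The value of a term. -/
noncomputable def ArithTerm.eval {R : ℕ} (s : Store R) : ArithTerm R → ℝ
  | .const n => (n : ℝ)
  | .reg i => s i
  | .add e f => e.eval s + f.eval s
  | .sub e f => e.eval s - f.eval s
  | .mul e f => e.eval s * f.eval s
  | .div e f => e.eval s / f.eval s
  | .floor e => (⌊e.eval s⌋ : ℝ)

/-- The time to evaluate a term: one step for every operation, constant and register access. -/
def ArithTerm.cost {R : ℕ} : ArithTerm R → ℕ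
  | .const _ => 1
  | .reg _ => 1
  | .add e f => e.cost + f.cost + 1
  | .sub e f => e.cost + f.cost + 1
  | .mul e f => e.cost + f.cost + 1
  | .div e f => e.cost + f.cost + 1
  | .floor e => e.cost + 1

/-- Comparisons of two terms. -/
inductive Test (R : ℕ) : Type
  | le (e f : ArithTerm R) : Test R
  | lt (e f : ArithTerm R) : Test R
  | eq (e f : ArithTerm R) : Test R

/-- The comparison succeeds. -/
def Test.Holds {R : ℕ} (s : Store R) : Test R → Prop
  | .le e f => e.eval s ≤ f.eval s
  | .lt e f => e.eval s < f.eval s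
  | .eq e f => e.eval s = f.eval s

/-- The time of a comparison. -/
def Test.cost {R : ℕ} : Test R → ℕ
  | .le e f => e.cost + f.cost + 1
  | .lt e f => e.cost + f.cost + 1
  | .eq e f => e.cost + f.cost + 1

/-- Programs. `query px py dx dy h ax ay bx by'` submits the line through `(px, py)` with direction
`(dx, dy)`; register `h` receives `0` if the answer is `none`, and otherwise `1`, and the two points
of the answer are stored in the last four registers. `write e f` outputs the point `(e, f)`. -/
inductive Program (R : ℕ) : Type
  | skip : Program R
  | assign (i : Fin R) (e : ArithTerm R) : Program R
  | query (px py dx dy : ArithTerm R) (h ax ay bx by' : Fin R) : Program R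
  | write (e f : ArithTerm R) : Program R
  | seq (P Q : Program R) : Program R
  | cond (b : Test R) (P Q : Program R) : Program R
  | loop (b : Test R) (P : Program R) : Program R

/-- The effect of the answer to a query on the registers. -/
noncomputable def recordAnswer {R : ℕ} (s : Store R) (h ax ay bx by' : Fin R) :
    Option (Plane × Plane) → Store R
  | none => Function.update s h 0
  | some (a, b) =>
      Function.update (Function.update (Function.update (Function.update (Function.update s
        h 1) ax (a 0)) ay (a 1)) bx (b 0)) by' (b 1)

/-- `Exec O P s s' out n`: started with register contents `s`, the program `P`, using the device
`O`, halts after `n` steps with register contents `s'`, having output the points in the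
list `out`. A line query takes one step (besides the evaluation of its arguments). -/
inductive Exec {R : ℕ} (O : LineOracle) :
    Program R → Store R → Store R → List Plane → ℕ → Prop
  | skip (s : Store R) : Exec O .skip s s [] 1
  | assign (s : Store R) (i : Fin R) (e : ArithTerm R) :
      Exec O (.assign i e) s (Function.update s i (e.eval s)) [] (e.cost + 1)
  | query (s : Store R) (px py dx dy : ArithTerm R) (h ax ay bx by' : Fin R) :
      Exec O (.query px py dx dy h ax ay bx by') s
        (recordAnswer s h ax ay bx by'
          (O !₂[px.eval s, py.eval s] !₂[dx.eval s, dy.eval s]))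
        [] (px.cost + py.cost + dx.cost + dy.cost + 1)
  | write (s : Store R) (e f : ArithTerm R) :
      Exec O (.write e f) s s [!₂[e.eval s, f.eval s]] (e.cost + f.cost + 1)
  | seq {P Q : Program R} {s₁ s₂ s₃ : Store R} {l₁ l₂ : List Plane} {n₁ n₂ : ℕ}
      (hP : Exec O P s₁ s₂ l₁ n₁) (hQ : Exec O Q s₂ s₃ l₂ n₂) :
      Exec O (.seq P Q) s₁ s₃ (l₁ ++ l₂) (n₁ + n₂)
  | condTrue {b : Test R} {P Q : Program R} {s s' : Store R} {l : List Plane} {n : ℕ}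
      (hb : b.Holds s) (hP : Exec O P s s' l n) :
      Exec O (.cond b P Q) s s' l (b.cost + n)
  | condFalse {b : Test R} {P Q : Program R} {s s' : Store R} {l : List Plane} {n : ℕ}
      (hb : ¬ b.Holds s) (hQ : Exec O Q s s' l n) :
      Exec O (.cond b P Q) s s' l (b.cost + n)
  | loopStop {b : Test R} {P : Program R} {s : Store R} (hb : ¬ b.Holds s) :
      Exec O (.loop b P) s s [] b.cost
  | loopStep {b : Test R} {P : Program R} {s₁ s₂ s₃ : Store R} {l₁ l₂ : List Plane} {n₁ n₂ : ℕ}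
      (hb : b.Holds s₁) (hP : Exec O P s₁ s₂ l₁ n₁) (hL : Exec O (.loop b P) s₂ s₃ l₂ n₂) :
      Exec O (.loop b P) s₁ s₃ (l₁ ++ l₂) (b.cost + n₁ + n₂)

/-- The machine is deterministic: final registers, output and number of steps are determined. -/
theorem Exec.deterministic {R : ℕ} {O : LineOracle} {P : Program R} {s s₁ s₂ : Store R}
    {l₁ l₂ : List Plane} {n₁ n₂ : ℕ} (h₁ : Exec O P s s₁ l₁ n₁) (h₂ : Exec O P s s₂ l₂ n₂) :
    s₁ = s₂ ∧ l₁ = l₂ ∧ n₁ = n₂ := by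
  induction h₁ generalizing s₂ l₂ n₂ with
  | skip | assign | query | write => cases h₂; exact ⟨rfl, rfl, rfl⟩
  | seq _ _ ihP ihQ =>
    cases h₂ with
    | seq hP hQ =>
      obtain ⟨rfl, rfl, rfl⟩ := ihP hP
      obtain ⟨rfl, rfl, rfl⟩ := ihQ hQ
      exact ⟨rfl, rfl, rfl⟩
  | condTrue hb _ ih =>
    cases h₂ with
    | condTrue _ h => obtain ⟨rfl, rfl, rfl⟩ := ih h; exact ⟨rfl, rfl, rfl⟩
    | condFalse hb' _ => exact absurd hb hb'
  | condFalse hb _ ih =>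
    cases h₂ with
    | condTrue hb' _ => exact absurd hb' hb
    | condFalse _ h => obtain ⟨rfl, rfl, rfl⟩ := ih h; exact ⟨rfl, rfl, rfl⟩
  | loopStop hb =>
    cases h₂ with
    | loopStop _ => exact ⟨rfl, rfl, rfl⟩
    | loopStep hb' _ _ => exact absurd hb' hb
  | loopStep hb _ _ ihP ihL =>
    cases h₂ with
    | loopStop hb' => exact absurd hb hb'
    | loopStep _ hP hL =>
      obtain ⟨rfl, rfl, rfl⟩ := ihP hP
      obtain ⟨rfl, rfl, rfl⟩ := ihL hL
      exact ⟨rfl, rfl, rfl⟩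

/-- The initial register contents: the coordinates of `v` in the first two registers, and `0`
in all others. -/
def inputStore (R : ℕ) (v : Plane) : Store R :=
  fun i => if i.val = 0 then v 0 else if i.val = 1 then v 1 else 0

/-- The list `l` is the counterclockwise boundary of the discrete hull of `C` from `v` on: it starts
with `v`, contains every vertex exactly once and nothing else, and the whole hull lies
weakly to the left of every directed edge from a vertex to its cyclic successor. -/
def IsHullBoundaryFrom (C : Set Plane) (v : Plane) (l : List Plane) : Prop :=
  l.head? = some v ∧ l.Nodup ∧ (∀ x, x ∈ l ↔ x ∈ hullVertices C) ∧
    (l ++ [v]).IsChain (fun a b => ∀ z ∈ discreteHull C, 0 ≤ cross (b - a) (z - a))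

end DiscreteHull

namespace DiscreteHull

/-! The hull is walked vertex by vertex. At a vertex `v` the successor lies in the most clockwise
direction `g` among the lattice vectors leading from `v` to other points of `C`. These steps lie in
an open half-plane, so orientation orders them transitively, and the four quadrants can be searched
one after another with a single current best direction.

A quadrant is a cone spanned by `A` and `B` with determinant -1, so its lattice vectors are the
integer combinations `a A + b B`. Since `C` is star-shaped around `v`, the ray of such a step meets
the line through `v + B` in direction `A` inside `C`, at parameter `a / b`. One line query thus
confines the slopes of all steps; rounding its end points yields either an answer or a smaller
unimodular cone, as in a continued fraction expansion. Alternating the roles of `A` and `B` at least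
doubles a linear weight of `A + B` per round (`narrow_yields`), while that weight is bounded by the
extent of `C`. Hence a logarithmic number of rounds suffices.

The direction found is primitive, so one more query along it gives the last lattice point of `C` on
the ray, which is the next vertex (`isNext_of_good`). The successor map is injective on the finite
set of vertices, so the walk returns to its start, and a separation argument
(`mem_of_closed_under_next`) shows that it misses no vertex. -/

/-! ### Rules for deriving executions with a time bound. -/

/-- An upper bound for the running time of a loop-free program. -/
def Program.bound {R : ℕ} : Program R → ℕ
  | .skip => 1
  | .assign _ e => e.cost + 1
  | .query a b c d _ _ _ _ _ => a.cost + b.cost + c.cost + d.cost + 1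
  | .write e f => e.cost + f.cost + 1
  | .seq P Q => P.bound + Q.bound
  | .cond b P Q => b.cost + max P.bound Q.bound
  -- Junk value: a loop takes at least one step, so `Yields` never holds for a loop. Loops are timed
  -- through `Reaches`.
  | .loop _ _ => 0

/-- `P`, started in `s`, halts within `c` steps without output, and the final store
satisfies `Q`. -/
def Reaches {R : ℕ} (O : LineOracle) (P : Program R) (s : Store R) (c : ℕ)
    (Q : Store R → Prop) : Prop :=
  ∃ s' n, Exec O P s s' [] n ∧ n ≤ c ∧ Q s'

/-- `Reaches` with the syntactic time bound of a loop-free program. -/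
def Yields {R : ℕ} (O : LineOracle) (P : Program R) (s : Store R) (Q : Store R → Prop) : Prop :=
  Reaches O P s P.bound Q

section Rules

variable {R : ℕ} {O : LineOracle} {P P' : Program R} {s : Store R} {Q Q' : Store R → Prop}
  {c c' : ℕ} {b : Test R}

theorem Reaches.mono (h : Reaches O P s c Q) (hc : c ≤ c') (hQ : ∀ s', Q s' → Q' s') :
    Reaches O P s c' Q' := by
  obtain ⟨s', n, he, hn, hq⟩ := h
  exact ⟨s', n, he, hn.trans hc, hQ _ hq⟩

theorem Reaches.seq (h : Reaches O P s c fun s' => Reaches O P' s' c' Q) :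
    Reaches O (.seq P P') s (c + c') Q := by
  obtain ⟨s', n, he, hn, s'', n', he', hn', hq⟩ := h
  exact ⟨s'', n + n', by simpa using Exec.seq he he', by omega, hq⟩

theorem Yields.mono (h : Yields O P s Q) (hQ : ∀ s', Q s' → Q' s') : Yields O P s Q' :=
  Reaches.mono h le_rfl hQ

theorem Yields.seq (h : Yields O P s fun s' => Yields O P' s' Q) : Yields O (.seq P P') s Q :=
  Reaches.seq h

theorem Yields.skip (h : Q s) : Yields O .skip s Q := ⟨s, 1, .skip s, le_rfl, h⟩

theorem Yields.assign {i : Fin R} {e : ArithTerm R} (h : Q (Function.update s i (e.eval s))) :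
    Yields O (.assign i e) s Q :=
  ⟨_, _, .assign s i e, le_rfl, h⟩

theorem Yields.cond (h : b.Holds s → Yields O P s Q) (h' : ¬ b.Holds s → Yields O P' s Q) :
    Yields O (.cond b P P') s Q := by
  by_cases hb : b.Holds s
  · obtain ⟨s', n, he, hn, hq⟩ := h hb
    exact ⟨s', _, .condTrue hb he, by simp only [Program.bound]; omega, hq⟩
  · obtain ⟨s', n, he, hn, hq⟩ := h' hb
    exact ⟨s', _, .condFalse hb he, by simp only [Program.bound]; omega, hq⟩

theorem Yields.query {px py dx dy : ArithTerm R} {h ax ay bx by' : Fin R}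
    (hq : Q (recordAnswer s h ax ay bx by'
      (O !₂[px.eval s, py.eval s] !₂[dx.eval s, dy.eval s]))) :
    Yields O (.query px py dx dy h ax ay bx by') s Q :=
  ⟨_, _, .query s px py dx dy h ax ay bx by', le_rfl, hq⟩

theorem Reaches.loopStop (hb : ¬ b.Holds s) (h : Q s) : Reaches O (.loop b P) s b.cost Q :=
  ⟨s, _, .loopStop hb, le_rfl, h⟩

theorem Reaches.loopStep (hb : b.Holds s)
    (h : Reaches O P s c fun s' => Reaches O (.loop b P) s' c' Q) :
    Reaches O (.loop b P) s (b.cost + c + c') Q := by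
  obtain ⟨s', n, he, hn, s'', n', he', hn', hq⟩ := h
  exact ⟨s'', b.cost + n + n', by simpa using Exec.loopStep hb he he', by omega, hq⟩

end Rules

/-! ### Line queries in terms of parameters on the line. -/

/-- The points `p + t d` of a segment on a line, in terms of the parameter `t`. -/
theorem mem_segment_line {p d : Plane} (hd : d ≠ 0) {α β : ℝ} (hαβ : α ≤ β) (t : ℝ) :
    p + t • d ∈ segment ℝ (p + α • d) (p + β • d) ↔ α ≤ t ∧ t ≤ β := by
  rw [← Set.mem_Icc, ← segment_eq_Icc hαβ]
  constructor
  · rintro ⟨a, b, ha, hb, hab, h⟩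
    refine ⟨a, b, ha, hb, hab, ?_⟩
    have h1 : (a * α + b * β - t) • d = 0 := by
      have : (a * α + b * β - t) • d
          = a • (p + α • d) + b • (p + β • d) - (p + t • d) + (1 - (a + b)) • p := by module
      rw [this, h, hab]; simp
    have := (smul_eq_zero.mp h1).resolve_right hd
    simp only [smul_eq_mul]; linarith
  · rintro ⟨a, b, ha, hb, hab, rfl⟩
    refine ⟨a, b, ha, hb, hab, ?_⟩
    have : a • (p + α • d) + b • (p + β • d)
        = (a + b) • p + (a • α + b • β) • d := by simp only [smul_eq_mul]; module
    rw [this, hab, one_smul]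

/-- The machine used below has 24 registers. -/
abbrev reg (i : Fin 24) : ArithTerm 24 := .reg i

/-- The parameter of the point with coordinates in the registers `i`, `j` on the line through
registers 20, 21 with direction in registers 22, 23. -/
def lineParam (i j : Fin 24) : ArithTerm 24 :=
  .div (.add (.mul (.sub (reg i) (reg 20)) (reg 22)) (.mul (.sub (reg j) (reg 21)) (reg 23)))
    (.add (.mul (reg 22) (reg 22)) (.mul (reg 23) (reg 23)))

/-- Submit the line through registers 20, 21 with direction in registers 22, 23, and put the
ordered parameters of the end points into registers 15, 16. -/
def lineQuery : Program 24 :=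
  .seq (.query (reg 20) (reg 21) (reg 22) (reg 23) 10 11 12 13 14)
  (.seq (.assign 15 (lineParam 11 12))
  (.seq (.assign 16 (lineParam 13 14))
  (.cond (.le (reg 15) (reg 16)) .skip
    (.seq (.assign 11 (reg 15)) (.seq (.assign 15 (reg 16)) (.assign 16 (reg 11)))))))

/-- The parameters `t` with `p + t d ∈ C` are described by the registers 10, 15, 16. -/
def LineAnswer (C : Set Plane) (px py dx dy : ℝ) (s : Store 24) : Prop :=
  (s 10 = 0 ∧ ∀ t : ℝ, !₂[px + t * dx, py + t * dy] ∉ C) ∨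
  (s 10 = 1 ∧ s 15 ≤ s 16 ∧ ∀ t : ℝ, !₂[px + t * dx, py + t * dy] ∈ C ↔ s 15 ≤ t ∧ t ≤ s 16)

/-- Projecting an end point onto the direction recovers its parameter, and a comparison sorts the
two parameters. For direction zero the answer is arbitrary, but the registers outside 10 to 16 are
still preserved; `advance` relies on this. -/
theorem lineQuery_yields {C : Set Plane} {O : LineOracle} (hO : O.Answers C) (s : Store 24) :
    Yields O lineQuery s fun s' =>
      (∀ i : Fin 24, i.val < 10 ∨ 17 ≤ i.val → s' i = s i) ∧
      (s 22 ≠ 0 ∨ s 23 ≠ 0 → LineAnswer C (s 20) (s 21) (s 22) (s 23) s') := by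
  have hne : ∀ i : Fin 24, i.val < 10 ∨ 17 ≤ i.val →
      i ≠ 10 ∧ i ≠ 11 ∧ i ≠ 12 ∧ i ≠ 13 ∧ i ≠ 14 ∧ i ≠ 15 ∧ i ≠ 16 := by decide
  refine .seq (.query ?_)
  set p : Plane := !₂[s 20, s 21] with hp
  set d : Plane := !₂[s 22, s 23] with hd
  have hline : ∀ t : ℝ, (!₂[s 20 + t * s 22, s 21 + t * s 23] : Plane) = p + t • d := by
    intro t; ext i; fin_cases i <;> simp [hp, hd]
  have hd0 : s 22 ≠ 0 ∨ s 23 ≠ 0 → d ≠ 0 := by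
    rintro h h0
    have h1 := congrArg (fun x : Plane => x 0) h0
    have h2 := congrArg (fun x : Plane => x 1) h0
    simp [hd] at h1 h2
    tauto
  have hans := hO p d
  change Yields O _ (recordAnswer s 10 11 12 13 14 (O p d)) _
  rcases hOpd : O p d with _ | ⟨a, b⟩
  · have key : ∀ s' : Store 24, (∀ i : Fin 24, i.val < 10 ∨ 17 ≤ i.val → s' i = s i) →
        s' 10 = 0 → (∀ i : Fin 24, i.val < 10 ∨ 17 ≤ i.val → s' i = s i) ∧
      (s 22 ≠ 0 ∨ s 23 ≠ 0 → LineAnswer C (s 20) (s 21) (s 22) (s 23) s') := by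
      refine fun s' h1 h2 => ⟨h1, fun hnz => .inl ⟨h2, fun t ht => ?_⟩⟩
      have := hans (hd0 hnz)
      rw [hOpd] at this
      exact (Set.eq_empty_iff_forall_notMem.mp this _) ⟨ht, t, hline t⟩
    refine .seq (.assign (.seq (.assign (.cond (fun _ => .skip ?_)
      (fun _ => .seq (.assign (.seq (.assign (.assign ?_)))))))))
    all_goals
      refine key _ (fun i hi => ?_) (by simp [recordAnswer])
      obtain ⟨h1, h2, h3, h4, h5, h6, h7⟩ := hne i hi
      simp [recordAnswer, *]
  · have key : ∀ s' : Store 24, (∀ i : Fin 24, i.val < 10 ∨ 17 ≤ i.val → s' i = s i) →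
        s' 10 = 1 →
        s' 15 = min (((a 0 - s 20) * s 22 + (a 1 - s 21) * s 23) / (s 22 * s 22 + s 23 * s 23))
          (((b 0 - s 20) * s 22 + (b 1 - s 21) * s 23) / (s 22 * s 22 + s 23 * s 23)) →
        s' 16 = max (((a 0 - s 20) * s 22 + (a 1 - s 21) * s 23) / (s 22 * s 22 + s 23 * s 23))
          (((b 0 - s 20) * s 22 + (b 1 - s 21) * s 23) / (s 22 * s 22 + s 23 * s 23)) →
        (∀ i : Fin 24, i.val < 10 ∨ 17 ≤ i.val → s' i = s i) ∧
      (s 22 ≠ 0 ∨ s 23 ≠ 0 → LineAnswer C (s 20) (s 21) (s 22) (s 23) s') := by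
      refine fun s' h1 h2 h3 h4 => ⟨h1, fun hnz => .inr ⟨h2, by rw [h3, h4]; exact min_le_max, fun t => ?_⟩⟩
      have h5 := hans (hd0 hnz)
      rw [hOpd] at h5
      replace h5 : C ∩ lineAt p d = segment ℝ a b := h5
      obtain ⟨-, ta, rfl⟩ : a ∈ C ∩ lineAt p d := h5 ▸ left_mem_segment ℝ a b
      obtain ⟨-, tb, rfl⟩ : b ∈ C ∩ lineAt p d := h5 ▸ right_mem_segment ℝ _ b
      have hpos : s 22 * s 22 + s 23 * s 23 ≠ 0 := by
        rcases hnz with h | h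
        · nlinarith [mul_self_pos.mpr h, mul_self_nonneg (s 23)]
        · nlinarith [mul_self_pos.mpr h, mul_self_nonneg (s 22)]
      have hta : ∀ u : ℝ, (((p + u • d) 0 - s 20) * s 22 + ((p + u • d) 1 - s 21) * s 23)
          / (s 22 * s 22 + s 23 * s 23) = u := by
        intro u
        rw [div_eq_iff hpos]
        simp [hp, hd]
        ring
      rw [hta, hta] at h3 h4
      have h6 : ∀ t : ℝ, p + t • d ∈ C ↔ p + t • d ∈ segment ℝ (p + ta • d) (p + tb • d) := by
        intro t
        rw [← h5]
        exact ⟨fun h => ⟨h, t, rfl⟩, fun h => h.1⟩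
      rw [hline, h6, h3, h4]
      rcases le_total ta tb with h | h
      · rw [min_eq_left h, max_eq_right h]; exact mem_segment_line (hd0 hnz) h t
      · rw [min_eq_right h, max_eq_left h, segment_symm]; exact mem_segment_line (hd0 hnz) h t
    refine .seq (.assign (.seq (.assign (.cond (fun hle => .skip ?_)
      (fun hle => .seq (.assign (.seq (.assign (.assign ?_)))))))))
    on_goal 2 => replace hle := (not_le.mp hle).le
    all_goals
      simp [Test.Holds, ArithTerm.eval, recordAnswer, lineParam] at hle
      refine key _ (fun i hi => ?_) (by simp [recordAnswer]) ?_ ?_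
      · obtain ⟨h1, h2, h3, h4, h5, h6, h7⟩ := hne i hi
        simp [recordAnswer, *]
      · simp [ArithTerm.eval, recordAnswer, lineParam, hle]
      · simp [ArithTerm.eval, recordAnswer, lineParam, hle]

/-! ### Searching a cone for the most clockwise lattice direction -/

/-- The determinant of two integer vectors. -/
def det2 (u v : ℤ × ℤ) : ℤ := u.1 * v.2 - u.2 * v.1

/-- The direction `p` is not strictly clockwise from `g`, where `0` precedes no direction. -/
def Good (g p : ℤ × ℤ) : Prop := g ≠ 0 ∧ 0 ≤ det2 g p

/-- The lattice vectors that lead from `v` to another point of `C`. -/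
def steps (C : Set Plane) (v : ℤ × ℤ) : Set (ℤ × ℤ) :=
  {p | p ≠ 0 ∧ !₂[(v.1 : ℝ) + p.1, (v.2 : ℝ) + p.2] ∈ C}

/-- `C` is star-shaped around `v`, and its steps lie in an open half-plane. -/
structure Apex (C : Set Plane) (v : ℤ × ℤ) : Prop where
  star : ∀ x y t : ℝ, !₂[(v.1 : ℝ) + x, (v.2 : ℝ) + y] ∈ C → 0 ≤ t → t ≤ 1 →
    !₂[(v.1 : ℝ) + t * x, (v.2 : ℝ) + t * y] ∈ C
  pointed : ∃ f₁ f₂ : ℝ, ∀ p ∈ steps C v, 0 < f₁ * p.1 + f₂ * p.2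

/-- Let `f` be the functional that is positive on all steps. Then `f(p) det(u,q) = f(u) det(p,q) +
f(q) det(u,p)`, and both terms on the right are nonnegative. -/
theorem Apex.det2_trans {C : Set Plane} {v u p q : ℤ × ℤ} (hC : Apex C v) (hu : u ∈ steps C v)
    (hp : p ∈ steps C v) (hq : q ∈ steps C v) (h : 0 ≤ det2 u p) (h' : 0 ≤ det2 p q) :
    0 ≤ det2 u q := by
  obtain ⟨f₁, f₂, hf⟩ := hC.pointed
  have h1 := hf u hu
  have h2 := hf p hp
  have h3 := hf q hq
  have e : (f₁ * p.1 + f₂ * p.2) * (det2 u q : ℝ)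
      = (f₁ * u.1 + f₂ * u.2) * (det2 p q : ℝ) + (f₁ * q.1 + f₂ * q.2) * (det2 u p : ℝ) := by
    simp only [det2]; push_cast; ring
  have h4 : (0 : ℝ) ≤ det2 u p := by exact_mod_cast h
  have h5 : (0 : ℝ) ≤ det2 p q := by exact_mod_cast h'
  have h6 : 0 ≤ (f₁ * p.1 + f₂ * p.2) * (det2 u q : ℝ) := by rw [e]; positivity
  exact_mod_cast nonneg_of_mul_nonneg_right h6 h2

theorem isCoprime_of_det2_left {A B : ℤ × ℤ} (h : det2 A B = -1) : IsCoprime A.1 A.2 :=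
  ⟨-B.2, B.1, by simp only [det2] at h; linarith⟩

theorem isCoprime_of_det2_right {A B : ℤ × ℤ} (h : det2 A B = -1) : IsCoprime B.1 B.2 :=
  ⟨A.2, -A.1, by simp only [det2] at h; linarith⟩

theorem ne_zero_of_isCoprime {A : ℤ × ℤ} (h : IsCoprime A.1 A.2) : A ≠ 0 := by
  rintro rfl
  exact not_isCoprime_zero_zero h

/-- Registers 4, 5 hold a primitive step, or `0`. -/
structure Best (C : Set Plane) (v : ℤ × ℤ) (s : Store 24) (g : ℤ × ℤ) : Prop where
  r4 : s 4 = g.1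
  r5 : s 5 = g.2
  valid : g = 0 ∨ g ∈ steps C v ∧ IsCoprime g.1 g.2

/-- Replace the direction in registers 4, 5 by the one in registers `i`, `j`, if the latter is
more clockwise. -/
def update45 (i j : Fin 24) : Program 24 :=
  .cond (.eq (.add (.mul (reg 4) (reg 4)) (.mul (reg 5) (reg 5))) (.const 0))
    (.seq (.assign 4 (reg i)) (.assign 5 (reg j)))
    (.cond (.lt (.sub (.mul (reg 4) (reg j)) (.mul (reg 5) (reg i))) (.const 0))
      (.seq (.assign 4 (reg i)) (.assign 5 (reg j))) .skip)

theorem update45_yields {C : Set Plane} {v : ℤ × ℤ} (hC : Apex C v) (O : LineOracle)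
    {s : Store 24} {g q : ℤ × ℤ} (hg : Best C v s g) (hq : q ∈ steps C v)
    (hq' : IsCoprime q.1 q.2) {i j : Fin 24} (hi : s i = q.1) (hj : s j = q.2) (hj4 : j ≠ 4) :
    Yields O (update45 i j) s fun s' => (∀ k, k ≠ 4 → k ≠ 5 → s' k = s k) ∧
      ∃ g', Best C v s' g' ∧ Good g' q ∧ ∀ p ∈ steps C v, Good g p → Good g' p := by
  have hset : (∀ p ∈ steps C v, Good g p → Good q p) →
      Yields O (.seq (.assign 4 (reg i)) (.assign 5 (reg j))) s fun s' =>
      (∀ k, k ≠ 4 → k ≠ 5 → s' k = s k) ∧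
      ∃ g', Best C v s' g' ∧ Good g' q ∧ ∀ p ∈ steps C v, Good g p → Good g' p := by
    intro h
    refine .seq (.assign (.assign ⟨fun k h4 h5 => by simp [h4, h5], q, ⟨?_, ?_, .inr ⟨hq, hq'⟩⟩,
      ⟨hq.1, by simp [det2, mul_comm]⟩, h⟩))
    · simp [ArithTerm.eval, hi]
    · simp [ArithTerm.eval, hj, hj4]
  refine .cond (fun h => hset ?_) (fun h => .cond (fun h' => hset ?_) (fun h' => .skip ?_))
  · simp only [Test.Holds, ArithTerm.eval, hg.r4, hg.r5] at h
    intro p hp hgp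
    refine absurd ?_ hgp.1
    norm_cast at h
    ext <;> simp <;> nlinarith [mul_self_nonneg g.1, mul_self_nonneg g.2]
  · simp only [Test.Holds, ArithTerm.eval, hg.r4, hg.r5, hi, hj] at h'
    norm_cast at h'
    intro p hp hgp
    have hgs : g ∈ steps C v := (hg.valid.resolve_left hgp.1).1
    refine ⟨hq.1, hC.det2_trans hq hgs hp ?_ hgp.2⟩
    simp only [det2]; linarith
  · simp only [Test.Holds, ArithTerm.eval, hg.r4, hg.r5, hi, hj] at h h'
    norm_cast at h h'
    refine ⟨fun _ _ _ => rfl, g, hg, ⟨?_, by simp only [det2]; linarith⟩, fun _ _ h => h⟩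
    rintro rfl
    simp at h

/-- The registers that are preserved by the search. -/
def Frame (s s' : Store 24) : Prop :=
  s' 0 = s 0 ∧ s' 1 = s 1 ∧ s' 2 = s 2 ∧ s' 3 = s 3 ∧ s' 19 = s 19

theorem Frame.trans {s s' s'' : Store 24} (h : Frame s s') (h' : Frame s' s'') :
    Frame s s'' := by
  obtain ⟨h0, h1, h2, h3, h4⟩ := h
  obtain ⟨k0, k1, k2, k3, k4⟩ := h'
  exact ⟨k0.trans h0, k1.trans h1, k2.trans h2, k3.trans h3, k4.trans h4⟩

/-- The state of the search of a cone for steps in `Y`: each of them is good for `g` or is a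
nonnegative combination of `A` and `B`. -/
structure Scan (C : Set Plane) (v : ℤ × ℤ) (Y : Set (ℤ × ℤ)) (σ : ℤ × ℤ) (lo : ℤ) (s : Store 24)
    (g A B : ℤ × ℤ) : Prop where
  r0 : s 0 = v.1
  r1 : s 1 = v.2
  best : Best C v s g
  r6 : s 6 = A.1
  r7 : s 7 = A.2
  r8 : s 8 = B.1
  r9 : s 9 = B.2
  det : det2 A B = -1
  -- The weight `σ` is positive on both generators; its growth limits the number of rounds.
  posA : 1 ≤ σ.1 * A.1 + σ.2 * A.2
  posB : 1 ≤ σ.1 * B.1 + σ.2 * B.2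
  -- The slope `a / b` used by `narrowB` needs `b ≥ 1`, and the slope `b / a` used by `narrowA`
  -- needs `a ≥ 1`. Hence `lo` is 0 before `narrowB` and 1 before `narrowA`.
  cover : ∀ p ∈ steps C v, p ∈ Y → Good g p ∨ ∃ a b : ℤ, lo ≤ a ∧ 1 ≤ b ∧ p = a • A + b • B

/-- The search is finished: registers 4, 5 hold a direction for which all steps in `Y` are good. -/
def Finished (C : Set Plane) (v : ℤ × ℤ) (Y : Set (ℤ × ℤ)) (s : Store 24) : Prop :=
  ∃ g, Best C v s g ∧ ∀ p ∈ steps C v, p ∈ Y → Good g p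

/-! ### Shrinking a unimodular cone by rounding the answer to a query. -/

/-- Shrink the cone by means of the query line through `B` in direction `A`. -/
def narrowB : Program 24 :=
  .seq (.assign 20 (.add (reg 0) (reg 8)))
  (.seq (.assign 21 (.add (reg 1) (reg 9)))
  (.seq (.assign 22 (reg 6))
  (.seq (.assign 23 (reg 7))
  (.seq lineQuery
  (.cond (.eq (reg 10) (.const 0)) (.assign 18 (.const 0))
  (.cond (.le (reg 15) (.const 0))
    (.seq (.assign 18 (.const 0)) (.cond (.le (.const 0) (reg 16)) (update45 8 9) .skip))
    (.seq (.assign 17 (.sub (.sub (.const 0) (.floor (.sub (.const 0) (reg 15)))) (.const 1)))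
    (.seq (.assign 8 (.add (reg 8) (.mul (reg 17) (reg 6))))
    (.seq (.assign 9 (.add (reg 9) (.mul (reg 17) (reg 7))))
    (.seq (.assign 6 (.add (reg 8) (reg 6)))
    (.seq (.assign 7 (.add (reg 9) (reg 7)))
    (.cond (.le (.add (reg 17) (.const 1)) (reg 16)) (update45 6 7) .skip))))))))))))

/-- Shrink the cone by means of the query line through `A` in direction `B`. -/
def narrowA : Program 24 :=
  .seq (.assign 20 (.add (reg 0) (reg 6)))
  (.seq (.assign 21 (.add (reg 1) (reg 7)))
  (.seq (.assign 22 (reg 8))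
  (.seq (.assign 23 (reg 9))
  (.seq lineQuery
  (.cond (.eq (reg 10) (.const 0)) (.assign 18 (.const 0))
  (.cond (.lt (reg 16) (.const 0)) (.assign 18 (.const 0))
    (.seq (.assign 17 (.floor (reg 16)))
    (.seq (.assign 6 (.add (reg 6) (.mul (reg 17) (reg 8))))
    (.seq (.assign 7 (.add (reg 7) (.mul (reg 17) (reg 9))))
    (.seq (.assign 8 (.add (reg 6) (reg 8)))
    (.seq (.assign 9 (.add (reg 7) (reg 9)))
    (.cond (.le (reg 15) (reg 17)) (update45 6 7) .skip))))))))))))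

/-- The point in which the ray of a step `a A + b B` meets the line through `B` in
direction `A`. -/
theorem Apex.mem_line {C : Set Plane} {v : ℤ × ℤ} (hC : Apex C v) {A B : ℤ × ℤ} {a b : ℤ}
    (hb : 1 ≤ b) (h : a • A + b • B ∈ steps C v) :
    !₂[(v.1 : ℝ) + B.1 + (a / b : ℝ) * A.1, (v.2 : ℝ) + B.2 + (a / b : ℝ) * A.2] ∈ C := by
  have hb' : (1 : ℝ) ≤ b := by exact_mod_cast hb
  have h0 : (b : ℝ) ≠ 0 := by positivity
  have := hC.star _ _ (1 / b : ℝ) h.2 (by positivity) (by rw [div_le_one (by positivity)]; exact hb')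
  convert this using 3
  · simp; field_simp; ring
  · simp; field_simp; ring

/-- `B` is the clockwise side of the cone, so the smallest slope `a / b` is sought. If `B` is itself
a step, nothing in the cone beats it. Otherwise the slopes of steps are bounded below by the left
end point of the answer, and the cone is cut between consecutive integer slopes `k` and `k + 1`
around that bound. Steps of slope at least `k + 1` are dominated by `A' = B + (k + 1) A` if `A'` is
a step, and do not exist otherwise. -/
theorem narrowB_yields {C : Set Plane} {O : LineOracle} (hO : O.Answers C) {v : ℤ × ℤ}
    (hC : Apex C v) {Y : Set (ℤ × ℤ)} {σ : ℤ × ℤ} {s : Store 24} {g A B : ℤ × ℤ}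
    (h : Scan C v Y σ 0 s g A B) (h18 : s 18 = 1) :
    Yields O narrowB s fun s' => Frame s s' ∧ (s' 18 = 0 ∧ Finished C v Y s' ∨
      s' 18 = 1 ∧ ∃ g' A' B', Scan C v Y σ 1 s' g' A' B' ∧
        σ.1 * A.1 + σ.2 * A.2 + (σ.1 * B.1 + σ.2 * B.2) ≤ σ.1 * A'.1 + σ.2 * A'.2 ∧
        σ.1 * B.1 + σ.2 * B.2 ≤ σ.1 * B'.1 + σ.2 * B'.2) := by
  refine .seq (.assign (.seq (.assign (.seq (.assign (.seq (.assign
    (.seq ((lineQuery_yields hO _).mono ?_)))))))))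
  rintro s₁ ⟨hfr, hans⟩
  have f0 := hfr 0 (by decide)
  have f1 := hfr 1 (by decide)
  have f2 := hfr 2 (by decide)
  have f3 := hfr 3 (by decide)
  have f4 := hfr 4 (by decide)
  have f5 := hfr 5 (by decide)
  have f6 := hfr 6 (by decide)
  have f7 := hfr 7 (by decide)
  have f8 := hfr 8 (by decide)
  have f9 := hfr 9 (by decide)
  have f18 := hfr 18 (by decide)
  have f19 := hfr 19 (by decide)
  simp [ArithTerm.eval, h.r0, h.r1, h.r6, h.r7, h.r8, h.r9, h.best.r4, h.best.r5, h18]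
    at f0 f1 f2 f3 f4 f5 f6 f7 f8 f9 f18 f19 hans
  clear hfr
  replace hans := hans (by
    by_contra hcon
    push Not at hcon
    exact ne_zero_of_isCoprime (isCoprime_of_det2_left h.det) (Prod.ext hcon.1 hcon.2))
  have frame : ∀ s' : Store 24, s' 0 = s₁ 0 → s' 1 = s₁ 1 → s' 2 = s₁ 2 → s' 3 = s₁ 3 →
      s' 19 = s₁ 19 → Frame s s' := by
    intro s' e0 e1 e2 e3 e4
    exact ⟨by rw [e0, f0, h.r0], by rw [e1, f1, h.r1], e2.trans f2, e3.trans f3, e4.trans f19⟩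
  have hb1 : Best C v s₁ g := ⟨f4, f5, h.best.valid⟩
  refine .cond (fun h10 => .assign ⟨frame _ (by simp) (by simp) (by simp) (by simp) (by simp),
    .inl ⟨by simp [ArithTerm.eval], g, ⟨by simp [f4], by simp [f5], h.best.valid⟩, ?_⟩⟩)
    (fun h10 => ?_)
  · simp [Test.Holds, ArithTerm.eval] at h10
    intro p hp hpY
    refine (h.cover p hp hpY).resolve_right ?_
    rintro ⟨a, b, -, hb, rfl⟩
    rcases hans with ⟨-, hans⟩ | ⟨h1, -⟩
    · exact hans _ (hC.mem_line hb hp)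
    · rw [h10] at h1; norm_num at h1
  simp [Test.Holds, ArithTerm.eval] at h10
  replace hans := (hans.resolve_left fun h => h10 h.1).2.2
  have hcov : ∀ p ∈ steps C v, p ∈ Y → Good g p ∨ ∃ a b : ℤ, 0 ≤ a ∧ 1 ≤ b ∧ p = a • A + b • B ∧
      s₁ 15 ≤ a / b ∧ (a / b : ℝ) ≤ s₁ 16 := by
    intro p hp hpY
    rcases h.cover p hp hpY with h1 | ⟨a, b, ha, hb, rfl⟩
    · exact .inl h1
    · exact .inr ⟨a, b, ha, hb, rfl, (hans _).mp (hC.mem_line hb hp)⟩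
  refine .cond (fun h15 => .seq (.assign (.cond (fun h16 => ?_) (fun h16 => .skip ?_))))
    (fun h15 => ?_)
  · simp [Test.Holds, ArithTerm.eval] at h15 h16
    have hBs : B ∈ steps C v := by
      refine ⟨ne_zero_of_isCoprime (isCoprime_of_det2_right h.det), ?_⟩
      simpa using (hans 0).mpr ⟨h15, h16⟩
    refine (update45_yields hC O (g := g) (q := B) ⟨by simp [f4], by simp [f5], h.best.valid⟩ hBs
      (isCoprime_of_det2_right h.det) (by simp [f8]) (by simp [f9]) (by decide)).mono ?_
    rintro s' ⟨hs', g', hg', hgB, hgood⟩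
    refine ⟨frame _ ?_ ?_ ?_ ?_ ?_, .inl ⟨?_, g', hg', ?_⟩⟩
    iterate 5 rw [hs' _ (by decide) (by decide)]; simp
    · rw [hs' _ (by decide) (by decide)]; simp [ArithTerm.eval]
    · intro p hp hpY
      rcases h.cover p hp hpY with h1 | ⟨a, b, ha, hb, rfl⟩
      · exact hgood _ hp h1
      · have hg's := (hg'.valid.resolve_left hgB.1).1
        refine ⟨hgB.1, hC.det2_trans hg's hBs hp hgB.2 ?_⟩
        have := h.det
        simp [det2] at this ⊢
        nlinarith
  · simp [Test.Holds, ArithTerm.eval] at h15 h16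
    refine ⟨frame _ (by simp) (by simp) (by simp) (by simp) (by simp),
      .inl ⟨by simp [ArithTerm.eval], g, ⟨by simp [f4], by simp [f5], h.best.valid⟩, ?_⟩⟩
    intro p hp hpY
    rcases hcov p hp hpY with h1 | ⟨a, b, ha, hb, rfl, h2, h3⟩
    · exact h1
    · have h4 : (0 : ℝ) ≤ a / b := by
        have : (0 : ℝ) ≤ a := by exact_mod_cast ha
        have : (0 : ℝ) ≤ b := by exact_mod_cast (by omega : 0 ≤ b)
        positivity
      linarith
  simp [Test.Holds, ArithTerm.eval] at h15
  -- The greatest integer strictly below the left end point. Strictness gives `k b < a`, so that the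
  -- new coefficient of `A'` is at least 1.
  obtain ⟨k, hk⟩ : ∃ k : ℤ, k = 0 - ⌊0 - s₁ 15⌋ - 1 := ⟨_, rfl⟩
  have hk1 : (k : ℝ) < s₁ 15 := by
    have := Int.lt_floor_add_one (0 - s₁ 15)
    rw [hk]; push_cast; linarith
  have hk2 : s₁ 15 ≤ k + 1 := by
    have := Int.floor_le (0 - s₁ 15)
    rw [hk]; push_cast; linarith
  have hk0 : 0 ≤ k := by
    have : (-1 : ℝ) < k := by linarith
    have : -1 < k := by exact_mod_cast this
    omega
  obtain ⟨B', hB'⟩ : ∃ B', B' = B + k • A := ⟨_, rfl⟩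
  obtain ⟨A', hA'⟩ : ∃ A', A' = B' + A := ⟨_, rfl⟩
  have hdet : det2 A' B' = -1 := by
    have := h.det
    subst hA' hB'
    simp [det2] at this ⊢
    linarith
  have hσB : σ.1 * B.1 + σ.2 * B.2 ≤ σ.1 * B'.1 + σ.2 * B'.2 := by
    have := h.posA
    subst hB'
    simp
    nlinarith
  have hσA : σ.1 * A'.1 + σ.2 * A'.2
      = σ.1 * A.1 + σ.2 * A.2 + (σ.1 * B'.1 + σ.2 * B'.2) := by
    subst hA'; simp; ring
  have hposA := h.posA
  have hposB := h.posB
  refine .seq (.assign (.seq (.assign (.seq (.assign (.seq (.assign (.seq (.assign ?_)))))))))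
  generalize hs2 : Function.update (β := fun _ : Fin 24 => ℝ) _ 7 _ = s₂
  have g0 : s₂ 0 = s₁ 0 := by subst hs2; simp
  have g1 : s₂ 1 = s₁ 1 := by subst hs2; simp
  have g2 : s₂ 2 = s₁ 2 := by subst hs2; simp
  have g3 : s₂ 3 = s₁ 3 := by subst hs2; simp
  have g4 : s₂ 4 = g.1 := by subst hs2; simp [f4]
  have g5 : s₂ 5 = g.2 := by subst hs2; simp [f5]
  have g16 : s₂ 16 = s₁ 16 := by subst hs2; simp
  have g17 : s₂ 17 = k := by subst hs2; simp [ArithTerm.eval, hk]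
  have g8 : s₂ 8 = B'.1 := by
    subst hs2; simp [ArithTerm.eval, f6, f8, hk, hB']
  have g9 : s₂ 9 = B'.2 := by
    subst hs2; simp [ArithTerm.eval, f7, f9, hk, hB']
  have g6 : s₂ 6 = A'.1 := by
    subst hs2; simp [ArithTerm.eval, f6, f8, hk, hB', hA']
  have g7 : s₂ 7 = A'.2 := by
    subst hs2; simp [ArithTerm.eval, f7, f9, hk, hB', hA']
  have g18 : s₂ 18 = 1 := by subst hs2; simp [f18]
  have g19 : s₂ 19 = s₁ 19 := by subst hs2; simp
  clear hs2
  have conv : ∀ a b : ℤ, 1 ≤ b → s₁ 15 ≤ a / b → k * b < a := by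
    intro a b hb hab
    have hb' : (0 : ℝ) < b := by exact_mod_cast (by omega : 0 < b)
    have h1 := hk1.trans_le hab
    rw [lt_div_iff₀ hb'] at h1
    exact_mod_cast h1
  have comb : ∀ a b : ℤ, a • A + b • B = (a - k * b) • A' + ((k + 1) * b - a) • B' := by
    intro a b
    subst hA' hB'
    ext <;> simp <;> ring
  refine .cond (fun h16 => ?_) (fun h16 => .skip ?_)
  · simp [Test.Holds, ArithTerm.eval, g17, g16] at h16
    have hAs : A' ∈ steps C v := by
      refine ⟨ne_zero_of_isCoprime (isCoprime_of_det2_left hdet), ?_⟩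
      have := (hans (k + 1)).mpr ⟨hk2, h16⟩
      convert this using 3
      · simp [hA', hB']; ring
      · simp [hA', hB']; ring
    refine (update45_yields hC O (g := g) (q := A') ⟨g4, g5, h.best.valid⟩ hAs
      (isCoprime_of_det2_left hdet) g6 g7 (by decide)).mono ?_
    rintro s' ⟨hs', g', hg', hgA, hgood⟩
    refine ⟨frame _ ?_ ?_ ?_ ?_ ?_, .inr ⟨?_, g', A', B', ⟨?_, ?_, hg', ?_, ?_, ?_, ?_, hdet,
      by linarith, by linarith, ?_⟩, by linarith, hσB⟩⟩
    iterate 12 rw [hs' _ (by decide) (by decide)]; first | assumption | simp [*]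
    intro p hp hpY
    rcases hcov p hp hpY with h1 | ⟨a, b, ha, hb, rfl, h2, h3⟩
    · exact .inl (hgood _ hp h1)
    · have h5 := conv a b hb h2
      rcases le_or_gt ((k + 1) * b) a with h4 | h4
      · left
        have hg's := (hg'.valid.resolve_left hgA.1).1
        refine ⟨hgA.1, hC.det2_trans hg's hAs hp hgA.2 ?_⟩
        have hd := hdet
        rw [comb]
        simp [det2] at hd ⊢
        nlinarith
      · exact .inr ⟨_, _, by linarith, by linarith, comb a b⟩
  · simp [Test.Holds, ArithTerm.eval, g17, g16] at h16
    refine ⟨frame _ g0 g1 g2 g3 g19, .inr ⟨g18, g, A', B', ⟨g0.trans f0, g1.trans f1,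
      ⟨g4, g5, h.best.valid⟩, g6, g7, g8, g9, hdet, by linarith, by linarith, ?_⟩,
      by linarith, hσB⟩⟩
    intro p hp hpY
    rcases hcov p hp hpY with h1 | ⟨a, b, ha, hb, rfl, h2, h3⟩
    · exact .inl h1
    · have h5 := conv a b hb h2
      have hb' : (0 : ℝ) < b := by exact_mod_cast (by omega : 0 < b)
      have h4 : a < (k + 1) * b := by
        have h1 := h3.trans_lt h16
        rw [div_lt_iff₀ hb'] at h1
        exact_mod_cast h1
      exact .inr ⟨_, _, by linarith, by linarith, comb a b⟩

/-- Now the slope is `b / a`, and clockwise means large. With `k` the floor of the right end point,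
every step has slope below `k + 1`. Steps of slope at most `k` are dominated by `A' = A + k B` if
`A'` is a step, and do not exist otherwise. The rest lies strictly inside the cone of `A'` and `A' +
B`. -/
theorem narrowA_yields {C : Set Plane} {O : LineOracle} (hO : O.Answers C) {v : ℤ × ℤ}
    (hC : Apex C v) {Y : Set (ℤ × ℤ)} {σ : ℤ × ℤ} {Δ : ℝ}
    (hΔ : ∀ x y : ℝ, !₂[(v.1 : ℝ) + x, (v.2 : ℝ) + y] ∈ C → σ.1 * x + σ.2 * y ≤ Δ)
    {s : Store 24} {g A B : ℤ × ℤ}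
    (h : Scan C v Y σ 1 s g A B) (h18 : s 18 = 1) :
    Yields O narrowA s fun s' => Frame s s' ∧ (s' 18 = 0 ∧ Finished C v Y s' ∨
      s' 18 = 1 ∧ ((σ.1 * A.1 + σ.2 * A.2 : ℤ) : ℝ) ≤ Δ ∧
        ∃ g' A' B', Scan C v Y σ 0 s' g' A' B' ∧
        σ.1 * A.1 + σ.2 * A.2 ≤ σ.1 * A'.1 + σ.2 * A'.2 ∧
        σ.1 * A.1 + σ.2 * A.2 + (σ.1 * B.1 + σ.2 * B.2) ≤ σ.1 * B'.1 + σ.2 * B'.2) := by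
  refine .seq (.assign (.seq (.assign (.seq (.assign (.seq (.assign
    (.seq ((lineQuery_yields hO _).mono ?_)))))))))
  rintro s₁ ⟨hfr, hans⟩
  have f0 := hfr 0 (by decide)
  have f1 := hfr 1 (by decide)
  have f2 := hfr 2 (by decide)
  have f3 := hfr 3 (by decide)
  have f4 := hfr 4 (by decide)
  have f5 := hfr 5 (by decide)
  have f6 := hfr 6 (by decide)
  have f7 := hfr 7 (by decide)
  have f8 := hfr 8 (by decide)
  have f9 := hfr 9 (by decide)
  have f18 := hfr 18 (by decide)
  have f19 := hfr 19 (by decide)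
  simp [ArithTerm.eval, h.r0, h.r1, h.r6, h.r7, h.r8, h.r9, h.best.r4, h.best.r5, h18]
    at f0 f1 f2 f3 f4 f5 f6 f7 f8 f9 f18 f19 hans
  clear hfr
  replace hans := hans (by
    by_contra hcon
    push Not at hcon
    exact ne_zero_of_isCoprime (isCoprime_of_det2_right h.det) (Prod.ext hcon.1 hcon.2))
  have frame : ∀ s' : Store 24, s' 0 = s₁ 0 → s' 1 = s₁ 1 → s' 2 = s₁ 2 → s' 3 = s₁ 3 →
      s' 19 = s₁ 19 → Frame s s' := by
    intro s' e0 e1 e2 e3 e4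
    exact ⟨by rw [e0, f0, h.r0], by rw [e1, f1, h.r1], e2.trans f2, e3.trans f3, e4.trans f19⟩
  have hline : ∀ a b : ℤ, 1 ≤ a → a • A + b • B ∈ steps C v →
      !₂[(v.1 : ℝ) + A.1 + (b / a : ℝ) * B.1, (v.2 : ℝ) + A.2 + (b / a : ℝ) * B.2] ∈ C :=
    fun a b ha hp => hC.mem_line ha (by rwa [add_comm])
  refine .cond (fun h10 => .assign ⟨frame _ (by simp) (by simp) (by simp) (by simp) (by simp),
    .inl ⟨by simp [ArithTerm.eval], g, ⟨by simp [f4], by simp [f5], h.best.valid⟩, ?_⟩⟩)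
    (fun h10 => ?_)
  · simp [Test.Holds, ArithTerm.eval] at h10
    intro p hp hpY
    refine (h.cover p hp hpY).resolve_right ?_
    rintro ⟨a, b, ha, hb, rfl⟩
    rcases hans with ⟨-, hans⟩ | ⟨h1, -⟩
    · exact hans _ (hline a b ha hp)
    · rw [h10] at h1; norm_num at h1
  simp [Test.Holds, ArithTerm.eval] at h10
  obtain ⟨-, h1516, hans⟩ := hans.resolve_left fun h => h10 h.1
  have hcov : ∀ p ∈ steps C v, p ∈ Y → Good g p ∨ ∃ a b : ℤ, 1 ≤ a ∧ 1 ≤ b ∧ p = a • A + b • B ∧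
      s₁ 15 ≤ b / a ∧ (b / a : ℝ) ≤ s₁ 16 := by
    intro p hp hpY
    rcases h.cover p hp hpY with h1 | ⟨a, b, ha, hb, rfl⟩
    · exact .inl h1
    · exact .inr ⟨a, b, ha, hb, rfl, (hans _).mp (hline a b ha hp)⟩
  refine .cond (fun h16 => .assign ⟨frame _ (by simp) (by simp) (by simp) (by simp) (by simp),
    .inl ⟨by simp [ArithTerm.eval], g, ⟨by simp [f4], by simp [f5], h.best.valid⟩, ?_⟩⟩)
    (fun h16 => ?_)
  · simp [Test.Holds, ArithTerm.eval] at h16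
    intro p hp hpY
    rcases hcov p hp hpY with h1 | ⟨a, b, ha, hb, rfl, h2, h3⟩
    · exact h1
    · have h4 : (0 : ℝ) ≤ b / a := by
        have : (0 : ℝ) ≤ a := by exact_mod_cast (by omega : 0 ≤ a)
        have : (0 : ℝ) ≤ b := by exact_mod_cast (by omega : 0 ≤ b)
        positivity
      linarith
  simp [Test.Holds, ArithTerm.eval] at h16
  have hposA := h.posA
  have hposB := h.posB
  -- The right end point `A + t B` of the answer has `t ≥ 0`, so it is a point of `C` (relative to
  -- `v`) of weight at least that of `A`.
  have hsize : ((σ.1 * A.1 + σ.2 * A.2 : ℤ) : ℝ) ≤ Δ := by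
    have h1 := hΔ (A.1 + s₁ 16 * B.1) (A.2 + s₁ 16 * B.2)
      (by simpa only [add_assoc] using (hans _).mpr ⟨h1516, le_rfl⟩)
    have h2 : (1 : ℝ) ≤ σ.1 * B.1 + σ.2 * B.2 := by exact_mod_cast hposB
    push_cast
    nlinarith
  obtain ⟨k, hk⟩ : ∃ k : ℤ, k = ⌊s₁ 16⌋ := ⟨_, rfl⟩
  have hk1 : s₁ 16 < k + 1 := by rw [hk]; exact Int.lt_floor_add_one _
  have hk2 : (k : ℝ) ≤ s₁ 16 := by rw [hk]; exact Int.floor_le _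
  have hk0 : 0 ≤ k := by rw [hk]; exact Int.floor_nonneg.mpr h16
  obtain ⟨A', hA'⟩ : ∃ A', A' = A + k • B := ⟨_, rfl⟩
  obtain ⟨B', hB'⟩ : ∃ B', B' = A' + B := ⟨_, rfl⟩
  have hdet : det2 A' B' = -1 := by
    have := h.det
    subst hB' hA'
    simp [det2] at this ⊢
    linarith
  have hσA : σ.1 * A.1 + σ.2 * A.2 ≤ σ.1 * A'.1 + σ.2 * A'.2 := by
    subst hA'
    simp
    nlinarith
  have hσB : σ.1 * B'.1 + σ.2 * B'.2
      = σ.1 * A'.1 + σ.2 * A'.2 + (σ.1 * B.1 + σ.2 * B.2) := by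
    subst hB'; simp; ring
  refine .seq (.assign (.seq (.assign (.seq (.assign (.seq (.assign (.seq (.assign ?_)))))))))
  generalize hs2 : Function.update (β := fun _ : Fin 24 => ℝ) _ 9 _ = s₂
  have g0 : s₂ 0 = s₁ 0 := by subst hs2; simp
  have g1 : s₂ 1 = s₁ 1 := by subst hs2; simp
  have g2 : s₂ 2 = s₁ 2 := by subst hs2; simp
  have g3 : s₂ 3 = s₁ 3 := by subst hs2; simp
  have g4 : s₂ 4 = g.1 := by subst hs2; simp [f4]
  have g5 : s₂ 5 = g.2 := by subst hs2; simp [f5]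
  have g15 : s₂ 15 = s₁ 15 := by subst hs2; simp
  have g17 : s₂ 17 = k := by subst hs2; simp [ArithTerm.eval, hk]
  have g6 : s₂ 6 = A'.1 := by
    subst hs2; simp [ArithTerm.eval, f6, f8, hk, hA']
  have g7 : s₂ 7 = A'.2 := by
    subst hs2; simp [ArithTerm.eval, f7, f9, hk, hA']
  have g8 : s₂ 8 = B'.1 := by
    subst hs2; simp [ArithTerm.eval, f6, f8, hk, hB', hA']
  have g9 : s₂ 9 = B'.2 := by
    subst hs2; simp [ArithTerm.eval, f7, f9, hk, hB', hA']
  have g18 : s₂ 18 = 1 := by subst hs2; simp [f18]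
  have g19 : s₂ 19 = s₁ 19 := by subst hs2; simp
  clear hs2
  have conv : ∀ a b : ℤ, 1 ≤ a → (b / a : ℝ) ≤ s₁ 16 → b < (k + 1) * a := by
    intro a b ha hab
    have ha' : (0 : ℝ) < a := by exact_mod_cast (by omega : 0 < a)
    have h1 := hab.trans_lt hk1
    rw [div_lt_iff₀ ha'] at h1
    exact_mod_cast h1
  have comb : ∀ a b : ℤ, a • A + b • B = ((k + 1) * a - b) • A' + (b - k * a) • B' := by
    intro a b
    subst hB' hA'
    ext <;> simp <;> ring
  refine .cond (fun h15 => ?_) (fun h15 => .skip ?_)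
  · simp [Test.Holds, ArithTerm.eval, g17, g15] at h15
    have hAs : A' ∈ steps C v := by
      refine ⟨ne_zero_of_isCoprime (isCoprime_of_det2_left hdet), ?_⟩
      have := (hans k).mpr ⟨h15, hk2⟩
      convert this using 3
      · simp [hA']; ring
      · simp [hA']; ring
    refine (update45_yields hC O (g := g) (q := A') ⟨g4, g5, h.best.valid⟩ hAs
      (isCoprime_of_det2_left hdet) g6 g7 (by decide)).mono ?_
    rintro s' ⟨hs', g', hg', hgA, hgood⟩
    refine ⟨frame _ ?_ ?_ ?_ ?_ ?_, .inr ⟨?_, hsize, g', A', B', ⟨?_, ?_, hg', ?_, ?_, ?_, ?_, hdet,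
      by linarith, by linarith, ?_⟩, hσA, by linarith⟩⟩
    iterate 12 rw [hs' _ (by decide) (by decide)]; first | assumption | simp [*]
    intro p hp hpY
    rcases hcov p hp hpY with h1 | ⟨a, b, ha, hb, rfl, h2, h3⟩
    · exact .inl (hgood _ hp h1)
    · have h5 := conv a b ha h3
      rcases le_or_gt b (k * a) with h4 | h4
      · left
        have hg's := (hg'.valid.resolve_left hgA.1).1
        refine ⟨hgA.1, hC.det2_trans hg's hAs hp hgA.2 ?_⟩
        have hd := hdet
        rw [comb]
        simp [det2] at hd ⊢
        nlinarith
      · exact .inr ⟨_, _, by linarith, by linarith, comb a b⟩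
  · simp [Test.Holds, ArithTerm.eval, g17, g15] at h15
    refine ⟨frame _ g0 g1 g2 g3 g19, .inr ⟨g18, hsize, g, A', B', ⟨g0.trans f0, g1.trans f1,
      ⟨g4, g5, h.best.valid⟩, g6, g7, g8, g9, hdet, by linarith, by linarith, ?_⟩,
      hσA, by linarith⟩⟩
    intro p hp hpY
    rcases hcov p hp hpY with h1 | ⟨a, b, ha, hb, rfl, h2, h3⟩
    · exact .inl h1
    · have h5 := conv a b ha h3
      have ha' : (0 : ℝ) < a := by exact_mod_cast (by omega : 0 < a)
      have h4 : k * a < b := by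
        have h1 := h15.trans_le h2
        rw [lt_div_iff₀ ha'] at h1
        exact_mod_cast h1
      exact .inr ⟨_, _, by linarith, by linarith, comb a b⟩

/-! ### Number of rounds and search of all directions. -/

/-- One round of the search. -/
def narrow : Program 24 := .seq narrowB (.cond (.eq (reg 18) (.const 1)) narrowA .skip)

/-- The half-rounds replace the weights `(α, β)` by at least `(α + β, β)` and then `(α + β, α +
2β)`, whose sum is at least `2(α + β)`. An unfinished second half bounds its incoming first weight,
hence `α + β`, by `Δ`. -/
theorem narrow_yields {C : Set Plane} {O : LineOracle} (hO : O.Answers C) {v : ℤ × ℤ}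
    (hC : Apex C v) {Y : Set (ℤ × ℤ)} {σ : ℤ × ℤ} {Δ : ℝ}
    (hΔ : ∀ x y : ℝ, !₂[(v.1 : ℝ) + x, (v.2 : ℝ) + y] ∈ C → σ.1 * x + σ.2 * y ≤ Δ)
    {s : Store 24} {g A B : ℤ × ℤ}
    (h : Scan C v Y σ 0 s g A B) (h18 : s 18 = 1) :
    Yields O narrow s fun s' => Frame s s' ∧ (s' 18 = 0 ∧ Finished C v Y s' ∨
      s' 18 = 1 ∧ ((σ.1 * A.1 + σ.2 * A.2 + (σ.1 * B.1 + σ.2 * B.2) : ℤ) : ℝ) ≤ Δ ∧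
        ∃ g' A' B', Scan C v Y σ 0 s' g' A' B' ∧
        2 * (σ.1 * A.1 + σ.2 * A.2 + (σ.1 * B.1 + σ.2 * B.2)) ≤
          σ.1 * A'.1 + σ.2 * A'.2 + (σ.1 * B'.1 + σ.2 * B'.2)) := by
  refine .seq ((narrowB_yields hO hC h h18).mono ?_)
  rintro s₁ ⟨hf, ⟨h0, hfin⟩ | ⟨h1, g₁, A₁, B₁, hs₁, hA, hB⟩⟩
  · refine .cond (fun hb => ?_) (fun _ => .skip ⟨hf, .inl ⟨h0, hfin⟩⟩)
    simp [Test.Holds, ArithTerm.eval, h0] at hb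
  · refine .cond (fun _ => ?_) (fun hb => ?_)
    · refine (narrowA_yields hO hC hΔ hs₁ h1).mono ?_
      rintro s₂ ⟨hf', ⟨h0, hfin⟩ | ⟨h2, hΔ', g₂, A₂, B₂, hs₂, hA', hB'⟩⟩
      · exact ⟨hf.trans hf', .inl ⟨h0, hfin⟩⟩
      · refine ⟨hf.trans hf', .inr ⟨h2, le_trans (by exact_mod_cast hA) hΔ', g₂, A₂, B₂, hs₂, ?_⟩⟩
        have := h.posB
        have := h.posA
        linarith
    · simp [Test.Holds, ArithTerm.eval, h1] at hb

/-- Each unfinished round doubles the total weight and so uses up one factor 2. At `j = 0` the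
weight already exceeds `Δ`, so that round must be the last. -/
theorem narrow_loop_reaches {C : Set Plane} {O : LineOracle} (hO : O.Answers C) {v : ℤ × ℤ}
    (hC : Apex C v) {Y : Set (ℤ × ℤ)} {σ : ℤ × ℤ} {Δ : ℝ}
    (hΔ : ∀ x y : ℝ, !₂[(v.1 : ℝ) + x, (v.2 : ℝ) + y] ∈ C → σ.1 * x + σ.2 * y ≤ Δ) (j : ℕ) :
    ∀ {s : Store 24} {g A B : ℤ × ℤ}, Scan C v Y σ 0 s g A B → s 18 = 1 →
      Δ < 2 ^ j * ((σ.1 * A.1 + σ.2 * A.2 + (σ.1 * B.1 + σ.2 * B.2) : ℤ) : ℝ) →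
      Reaches O (.loop (.eq (reg 18) (.const 1)) narrow) s ((j + 1) * (narrow.bound + 3) + 3)
        fun s' => Frame s s' ∧ Finished C v Y s' := by
  have hcost : (Test.eq (reg 18) (.const 1)).cost = 3 := rfl
  induction j with
  | zero =>
    intro s g A B h h18 hj
    refine (Reaches.loopStep (by simp [Test.Holds, ArithTerm.eval, h18])
      ((narrow_yields hO hC hΔ h h18).mono (Q' := fun s' => Reaches O _ s' 3 _)
      ?_)).mono ?_ (fun _ h => h)
    · rintro s₁ ⟨hf, ⟨h0, hfin⟩ | ⟨h1, hle, -⟩⟩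
      · exact .loopStop (by simp [Test.Holds, ArithTerm.eval, h0]) ⟨hf, hfin⟩
      · simp only [pow_zero, one_mul] at hj
        exact absurd hle (not_le.mpr hj)
    · rw [hcost]; omega
  | succ j ih =>
    intro s g A B h h18 hj
    refine (Reaches.loopStep (by simp [Test.Holds, ArithTerm.eval, h18])
      ((narrow_yields hO hC hΔ h h18).mono
        (Q' := fun s' => Reaches O _ s' ((j + 1) * (narrow.bound + 3) + 3) _)
      ?_)).mono ?_ (fun _ h => h)
    · rintro s₁ ⟨hf, ⟨h0, hfin⟩ | ⟨h1, hle, g', A', B', hs₁, hgrow⟩⟩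
      · refine (Reaches.loopStop (by simp [Test.Holds, ArithTerm.eval, h0]) ⟨hf, hfin⟩).mono ?_
          (fun _ h => h)
        rw [hcost]; omega
      · refine (ih hs₁ h1 (hj.trans_le ?_)).mono le_rfl (fun s' h => ⟨hf.trans h.1, h.2⟩)
        rw [pow_succ, mul_assoc]
        gcongr
        exact_mod_cast hgrow
    · rw [hcost]; ring_nf; omega

/-- The quadrant that is clockwise next to the direction `(-y, x)`. -/
def quadrant (x y : ℤ) : Set (ℤ × ℤ) :=
  {p | ∃ a b : ℤ, 0 ≤ a ∧ 1 ≤ b ∧ p = a • (-y, x) + b • (x, y)}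

/-- The search of a quadrant. -/
def searchQuadrant (x y : ℤ) : Program 24 :=
  .seq (.assign 6 (.const (-y)))
  (.seq (.assign 7 (.const x))
  (.seq (.assign 8 (.const x))
  (.seq (.assign 9 (.const y))
  (.seq (.assign 18 (.const 1)) (.loop (.eq (reg 18) (.const 1)) narrow)))))

/-- A bound for the time of the search of a quadrant. -/
def searchTime (j : ℕ) : ℕ := (j + 1) * (narrow.bound + 3) + 13

theorem searchQuadrant_reaches {C : Set Plane} {O : LineOracle} (hO : O.Answers C) {v : ℤ × ℤ}
    (hC : Apex C v) {Y : Set (ℤ × ℤ)} {δ : ℝ}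
    (hδ : ∀ x y : ℝ, !₂[(v.1 : ℝ) + x, (v.2 : ℝ) + y] ∈ C → |x| ≤ δ ∧ |y| ≤ δ) {j : ℕ}
    (hj : δ < 2 ^ j) {s : Store 24} (h0 : s 0 = v.1) (h1 : s 1 = v.2) (hs : Finished C v Y s)
    {x y : ℤ} (hxy : (x, y) ∈ ({(1, 0), (0, 1), (-1, 0), (0, -1)} : Set (ℤ × ℤ))) :
    Reaches O (searchQuadrant x y) s (searchTime j)
      fun s' => Frame s s' ∧ Finished C v (Y ∪ quadrant x y) s' := by
  obtain ⟨g, hg, hgY⟩ := hs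
  have hsq : x * x + y * y = 1 := by
    simp at hxy
    rcases hxy with ⟨rfl, rfl⟩ | ⟨rfl, rfl⟩ | ⟨rfl, rfl⟩ | ⟨rfl, rfl⟩ <;> norm_num
  have hΔ : ∀ a b : ℝ, !₂[(v.1 : ℝ) + a, (v.2 : ℝ) + b] ∈ C →
      ((x - y, x + y) : ℤ × ℤ).1 * a + ((x - y, x + y) : ℤ × ℤ).2 * b ≤ 2 * δ := by
    intro a b hab
    obtain ⟨ha, hb⟩ := hδ a b hab
    rw [abs_le] at ha hb
    simp at hxy
    rcases hxy with ⟨rfl, rfl⟩ | ⟨rfl, rfl⟩ | ⟨rfl, rfl⟩ | ⟨rfl, rfl⟩ <;> simp <;> linarith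
  have key : ∀ s' : Store 24, Frame s s' → s' 4 = s 4 → s' 5 = s 5 → s' 6 = (-y : ℤ) → s' 7 = x →
      s' 8 = x → s' 9 = y → s' 18 = 1 → Reaches O (.loop (.eq (reg 18) (.const 1)) narrow) s'
        ((j + 1) * (narrow.bound + 3) + 3)
        fun s' => Frame s s' ∧ Finished C v (Y ∪ quadrant x y) s' := by
    intro s' hf h4 h5 h6 h7 h8 h9 h18
    refine (narrow_loop_reaches hO hC (Y := Y ∪ quadrant x y) (σ := (x - y, x + y)) hΔ j
      (g := g) (A := (-y, x)) (B := (x, y))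
      ⟨hf.1.trans h0, hf.2.1.trans h1, ⟨h4.trans hg.r4, h5.trans hg.r5, hg.valid⟩, h6, h7, h8, h9,
        ?_, ?_, ?_, ?_⟩ h18 ?_).mono le_rfl (fun _ h => ⟨hf.trans h.1, h.2⟩)
    · simp only [det2]; linarith
    · dsimp only; linarith
    · dsimp only; linarith
    · rintro p hp (hpY | hpq)
      · exact .inl (hgY p hp hpY)
      · exact .inr hpq
    · have : (x - y) * -y + (x + y) * x + ((x - y) * x + (x + y) * y) = 2 := by linarith
      dsimp only
      rw [this]
      push_cast
      linarith
  have hassign : ∀ {Q : Store 24 → Prop} {P : Program 24} {i : Fin 24} {n : ℤ} {s : Store 24}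
      {c : ℕ}, Reaches O P (Function.update s i n) c Q →
        Reaches O (.seq (.assign i (.const n)) P) s (2 + c) Q := by
    intro Q P i n s c h
    exact .seq (Yields.assign h)
  refine (hassign <| hassign <| hassign <| hassign <| hassign <| key _ ?_ ?_ ?_ ?_ ?_ ?_ ?_ ?_).mono
    (by simp only [searchTime]; omega) (fun _ h => h)
  · simp [Frame]
  all_goals simp

/-- The search for the most clockwise step. -/
def search : Program 24 :=
  .seq (.seq (.assign 4 (.const 0)) (.assign 5 (.const 0)))
  (.seq (searchQuadrant 1 0)
  (.seq (searchQuadrant 0 1)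
  (.seq (searchQuadrant (-1) 0) (searchQuadrant 0 (-1)))))

theorem search_reaches {C : Set Plane} {O : LineOracle} (hO : O.Answers C) {v : ℤ × ℤ}
    (hC : Apex C v) {δ : ℝ}
    (hδ : ∀ x y : ℝ, !₂[(v.1 : ℝ) + x, (v.2 : ℝ) + y] ∈ C → |x| ≤ δ ∧ |y| ≤ δ) {j : ℕ}
    (hj : δ < 2 ^ j) {s : Store 24} (h0 : s 0 = v.1) (h1 : s 1 = v.2) :
    Reaches O search s (4 * searchTime j + 4)
      fun s' => Frame s s' ∧ ∃ g, Best C v s' g ∧ ∀ p ∈ steps C v, Good g p := by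
  have h4 : Program.bound (R := 24) (.seq (.assign 4 (.const 0)) (.assign 5 (.const 0))) = 4 := rfl
  refine (Reaches.seq (c' := 4 * searchTime j) (Yields.seq (.assign (.assign ?_)))).mono
    (by rw [h4]; omega) (fun _ h => h)
  generalize hs1 : Function.update (β := fun _ : Fin 24 => ℝ) _ 5 _ = s₁
  have hf : Frame s s₁ := by subst hs1; simp [Frame]
  have hfin : Finished C v ∅ s₁ := by
    subst hs1
    exact ⟨0, ⟨by simp [ArithTerm.eval], by simp [ArithTerm.eval], .inl rfl⟩, by simp⟩
  clear hs1
  have next : ∀ {s₁ : Store 24} {Y : Set (ℤ × ℤ)} {x y : ℤ},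
      (x, y) ∈ ({(1, 0), (0, 1), (-1, 0), (0, -1)} : Set (ℤ × ℤ)) → Frame s s₁ →
      Finished C v Y s₁ → Reaches O (searchQuadrant x y) s₁ (searchTime j)
      fun s' => Frame s s' ∧ Finished C v (Y ∪ quadrant x y) s' := by
    intro s₁ Y x y hxy hf hfin
    exact (searchQuadrant_reaches hO hC hδ hj (hf.1.trans h0) (hf.2.1.trans h1) hfin hxy).mono
      le_rfl (fun _ h => ⟨hf.trans h.1, h.2⟩)
  have time : 4 * searchTime j
      = searchTime j + (searchTime j + (searchTime j + searchTime j)) := by ring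
  rw [time]
  refine .seq ((next (by simp) hf hfin).mono le_rfl fun s₂ ⟨hf₂, h₂⟩ => ?_)
  refine .seq ((next (by simp) hf₂ h₂).mono le_rfl fun s₃ ⟨hf₃, h₃⟩ => ?_)
  refine .seq ((next (by simp) hf₃ h₃).mono le_rfl fun s₄ ⟨hf₄, h₄⟩ => ?_)
  refine (next (by simp) hf₄ h₄).mono le_rfl fun s₅ ⟨hf₅, g, hg, hgood⟩ => ?_
  refine ⟨hf₅, g, hg, fun p hp => hgood p hp ?_⟩
  have hp0 : p.1 ≠ 0 ∨ p.2 ≠ 0 := by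
    by_contra hcon
    push Not at hcon
    exact hp.1 (Prod.ext hcon.1 hcon.2)
  -- The four half-open quadrants cover all nonzero vectors.
  by_cases c1 : 1 ≤ p.1 ∧ 0 ≤ p.2
  · exact .inl (.inl (.inl (.inr ⟨p.2, p.1, c1.2, c1.1, by ext <;> simp⟩)))
  by_cases c2 : 1 ≤ p.2 ∧ p.1 ≤ 0
  · exact .inl (.inl (.inr ⟨-p.1, p.2, by omega, c2.1, by ext <;> simp⟩))
  by_cases c3 : p.1 ≤ -1 ∧ p.2 ≤ 0
  · exact .inl (.inr ⟨-p.2, -p.1, by omega, by omega, by ext <;> simp⟩)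
  · exact .inr ⟨p.1, -p.2, by omega, by omega, by ext <;> simp⟩

/-! ### The discrete hull -/

/-- The point of the plane with integer coordinates `p`. -/
def pt (p : ℤ × ℤ) : Plane := !₂[(p.1 : ℝ), (p.2 : ℝ)]

@[simp] theorem pt_zero_coord (p : ℤ × ℤ) : pt p 0 = p.1 := rfl

@[simp] theorem pt_one_coord (p : ℤ × ℤ) : pt p 1 = p.2 := rfl

theorem pt_injective : Function.Injective pt := by
  intro p q h
  have h0 := congrArg (fun x : Plane => x 0) h
  have h1 := congrArg (fun x : Plane => x 1) h
  simp at h0 h1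
  exact Prod.ext h0 h1

theorem pt_add (p q : ℤ × ℤ) : pt (p + q) = !₂[(p.1 : ℝ) + q.1, (p.2 : ℝ) + q.2] := by
  ext i; fin_cases i <;> simp [pt]

theorem mem_lattice {x : Plane} : x ∈ lattice ↔ ∃ p, x = pt p := by
  constructor
  · intro h
    obtain ⟨a, ha⟩ := h 0
    obtain ⟨b, hb⟩ := h 1
    refine ⟨(a, b), ?_⟩
    ext i; fin_cases i <;> simp [ha, hb]
  · rintro ⟨p, rfl⟩ i
    fin_cases i
    · exact ⟨p.1, rfl⟩
    · exact ⟨p.2, rfl⟩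

theorem pt_mem_lattice (p : ℤ × ℤ) : pt p ∈ lattice := mem_lattice.mpr ⟨p, rfl⟩

theorem mem_steps {C : Set Plane} {v p : ℤ × ℤ} : p ∈ steps C v ↔ p ≠ 0 ∧ pt (v + p) ∈ C := by
  rw [pt_add]; rfl

theorem abs_coord_sub_le_diam {C : Set Plane} (hC : Bornology.IsBounded C) {x y : Plane}
    (hx : x ∈ C) (hy : y ∈ C) (i : Fin 2) : |x i - y i| ≤ Metric.diam C := by
  refine le_trans ?_ (Metric.dist_le_diam_of_mem hC hx hy)
  rw [dist_eq_norm]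
  simpa using PiLp.norm_apply_le (x - y) i

theorem finite_inter_lattice {C : Set Plane} (hC : Bornology.IsBounded C) :
    (C ∩ lattice).Finite := by
  rcases (C ∩ lattice).eq_empty_or_nonempty with h | ⟨x, hx, hxl⟩
  · rw [h]; exact Set.finite_empty
  obtain ⟨p, rfl⟩ := mem_lattice.mp hxl
  obtain ⟨n, hn⟩ := exists_nat_ge (Metric.diam C)
  refine ((Set.finite_Icc (p - ((n : ℤ), (n : ℤ))) (p + ((n : ℤ), (n : ℤ)))).image pt).subset ?_
  rintro y ⟨hy, hyl⟩
  obtain ⟨q, rfl⟩ := mem_lattice.mp hyl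
  have h0 := abs_le.mp ((abs_coord_sub_le_diam hC hy hx 0).trans hn)
  have h1 := abs_le.mp ((abs_coord_sub_le_diam hC hy hx 1).trans hn)
  simp only [pt_zero_coord, pt_one_coord] at h0 h1
  norm_cast at h0 h1
  refine ⟨q, ⟨⟨?_, ?_⟩, ⟨?_, ?_⟩⟩, rfl⟩ <;> simp <;> omega

theorem hullVertices_subset (C : Set Plane) : hullVertices C ⊆ C ∩ lattice :=
  extremePoints_convexHull_subset

theorem inter_lattice_subset (C : Set Plane) : C ∩ lattice ⊆ discreteHull C :=
  subset_convexHull ℝ _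

/-- A vertex is the only minimizer of some linear functional. -/
theorem exists_functional {C : Set Plane} (hC : Bornology.IsBounded C) {v : Plane}
    (hv : v ∈ hullVertices C) :
    ∃ f : Plane →L[ℝ] ℝ, ∀ x ∈ C ∩ lattice, x ≠ v → f v < f x := by
  have h : v ∉ convexHull ℝ ((C ∩ lattice) \ {v}) := by
    have h1 := ((convex_convexHull ℝ _).mem_extremePoints_iff_mem_sdiff_convexHull_sdiff.mp hv).2
    exact fun h2 => h1 (convexHull_mono (Set.sdiff_subset_sdiff_left (subset_convexHull ℝ _)) h2)
  obtain ⟨f, u, hf, hu⟩ := geometric_hahn_banach_point_closed (convex_convexHull ℝ _)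
    (((finite_inter_lattice hC).sdiff).isClosed_convexHull ℝ) h
  exact ⟨f, fun x hx hxv => hf.trans (hu x (subset_convexHull ℝ _ ⟨hx, hxv⟩))⟩

/-- The point `w` together with the open half-plane `f < f w` is a convex set containing all lattice
points of `C`, hence the hull; so `w` is an exposed point. -/
theorem mem_hullVertices_of_unique_max {C : Set Plane} {w : Plane} (hw : w ∈ C ∩ lattice)
    (f : Plane →L[ℝ] ℝ) (hf : ∀ x ∈ C ∩ lattice, x ≠ w → f x < f w) : w ∈ hullVertices C := by
  have hconv : Convex ℝ {x | x = w ∨ f x < f w} := by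
    rw [convex_iff_forall_pos]
    intro x hx y hy a b ha hb hab
    have hsum : f (a • x + b • y) = a * f x + b * f y := by simp
    have ha' : a = 1 - b := by linarith
    rcases hx with rfl | hx
    · rcases hy with rfl | hy
      · exact .inl (by rw [← add_smul, hab, one_smul])
      · right; rw [hsum]; subst ha'; nlinarith
    · right
      rw [hsum]
      have hy' : f y ≤ f w := by
        rcases hy with rfl | hy
        · exact le_rfl
        · exact hy.le
      subst ha'
      nlinarith
  have hsub : discreteHull C ⊆ {x | x = w ∨ f x < f w} :=
    convexHull_min (fun x hx => by
      by_cases h : x = w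
      · exact .inl h
      · exact .inr (hf x hx h)) hconv
  refine exposedPoints_subset_extremePoints ⟨inter_lattice_subset C hw, f, fun y hy => ?_⟩
  rcases hsub hy with rfl | h
  · simp
  · exact ⟨h.le, fun h' => absurd h (not_lt.mpr h')⟩

theorem cross_nonneg_of_lattice {C : Set Plane} {u a : Plane}
    (h : ∀ z ∈ C ∩ lattice, 0 ≤ cross u (z - a)) : ∀ z ∈ discreteHull C, 0 ≤ cross u (z - a) := by
  have hconv : Convex ℝ {z | 0 ≤ cross u (z - a)} := by
    intro x hx y hy s t hs ht hst
    simp only [Set.mem_ofPred_eq, cross] at hx hy ⊢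
    have hs' : s = 1 - t := by linarith
    have e : u 0 * (s • x + t • y - a) 1 - u 1 * (s • x + t • y - a) 0
        = s * (u 0 * (x - a) 1 - u 1 * (x - a) 0) + t * (u 0 * (y - a) 1 - u 1 * (y - a) 0) := by
      subst hs'
      simp
      ring
    rw [e]
    positivity
  exact fun z hz => convexHull_min h hconv hz

/-- No three different vertices of a hull are collinear. -/
theorem eq_of_cross_eq_zero {C : Set Plane} {a b c : Plane} (ha : a ∈ hullVertices C)
    (hb : b ∈ hullVertices C) (hc : c ∈ hullVertices C) (hab : a ≠ b)
    (h : cross (b - a) (c - a) = 0) : c = a ∨ c = b := by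
  obtain ⟨r, hr⟩ : ∃ r : ℝ, c = a + r • (b - a) := by
    have hne : (b 0 - a 0) ^ 2 + (b 1 - a 1) ^ 2 ≠ 0 := by
      intro h0
      refine hab ?_
      ext i
      fin_cases i <;> simp <;> nlinarith [sq_nonneg (b 0 - a 0), sq_nonneg (b 1 - a 1)]
    refine ⟨((c 0 - a 0) * (b 0 - a 0) + (c 1 - a 1) * (b 1 - a 1))
      / ((b 0 - a 0) ^ 2 + (b 1 - a 1) ^ 2), ?_⟩
    simp only [cross, PiLp.sub_apply] at h
    ext i
    fin_cases i
    · simp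
      field_simp
      linear_combination (-(b 1 - a 1)) * h
    · simp
      field_simp
      linear_combination (b 0 - a 0) * h
  have key : ∀ {x y z : Plane} {t : ℝ}, x ∈ hullVertices C → y ∈ hullVertices C →
      z ∈ hullVertices C → 0 < t → t < 1 → z = x + t • (y - x) → x = z := by
    intro x y z t hx hy hz h0 h1 e
    refine (mem_extremePoints.mp hz).2 x hx.1 y hy.1 ?_ |>.1
    exact ⟨1 - t, t, by linarith, h0, by ring, by rw [e]; module⟩
  rcases eq_or_ne r 0 with rfl | h0
  · left; rw [hr]; simp
  rcases eq_or_ne r 1 with rfl | h1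
  · right; rw [hr]; simp
  exfalso
  have hb1 : b = a + r⁻¹ • (c - a) := by
    rw [hr]; simp [smul_smul, h0]
  -- According to the position of `r` relative to 0 and 1, one of the three points lies strictly
  -- between the other two and cannot be extreme.
  rcases lt_or_gt_of_ne h0 with h0 | h0
  · have ha1 : a = b + (1 - r)⁻¹ • (c - b) := by
      have h2 : c - b = (1 - r) • (a - b) := by rw [hr]; module
      rw [h2, smul_smul, inv_mul_cancel₀ (by linarith)]; simp
    exact hab (key hb hc ha (by simp; linarith) (inv_lt_one_of_one_lt₀ (by linarith)) ha1).symm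
  rcases lt_or_gt_of_ne h1 with h1 | h1
  · have h2 := key ha hb hc h0 h1 hr
    rw [← h2] at hb1
    simp at hb1
    exact hab hb1.symm
  · exact hab (key ha hc hb (by positivity) (inv_lt_one_of_one_lt₀ h1) hb1)

/-! ### The successor relation on vertices. -/

/-- The vertex `w` is the counterclockwise successor of the vertex `v`. -/
structure IsNext (C : Set Plane) (v w : Plane) : Prop where
  mem : w ∈ hullVertices C
  left : ∀ z ∈ discreteHull C, 0 ≤ cross (w - v) (z - v)
  -- For `w = v` the condition `left` is vacuous; this clause admits that case only for a one-point
  -- hull.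
  single : w = v → ∀ x ∈ hullVertices C, x = v

/-- Two successors lie weakly to the left of each other as seen from `v`, so they are collinear with
`v`; three distinct vertices never are. -/
theorem IsNext.unique {C : Set Plane} {v w w' : Plane} (hv : v ∈ hullVertices C)
    (h : IsNext C v w) (h' : IsNext C v w') : w = w' := by
  by_cases hw : w = v
  · exact hw.trans (h.single hw w' h'.mem).symm
  by_cases hw' : w' = v
  · exact (h'.single hw' w h.mem).trans hw'.symm
  have h1 := h.left w' h'.mem.1
  have h2 := h'.left w h.mem.1
  refine ((eq_of_cross_eq_zero hv h.mem h'.mem (Ne.symm hw) ?_).resolve_left hw').symm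
  simp only [cross] at h1 h2 ⊢
  linarith

theorem IsNext.injective {C : Set Plane} {v v' w : Plane} (hv : v ∈ hullVertices C)
    (hv' : v' ∈ hullVertices C) (h : IsNext C v w) (h' : IsNext C v' w) : v = v' := by
  by_cases hw : w = v
  · exact (h.single hw v' hv').symm
  by_cases hw' : w = v'
  · exact h'.single hw' v hv
  have h1 := h.left v' hv'.1
  have h2 := h'.left v hv.1
  refine ((eq_of_cross_eq_zero hv h.mem hv' (Ne.symm hw) ?_).resolve_right (Ne.symm hw')).symm
  simp only [cross, PiLp.sub_apply] at h1 h2 ⊢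
  linarith

/-- A nonempty set of vertices on which "successor" and "predecessor" can be taken
contains all vertices. -/
theorem mem_of_closed_under_next {C : Set Plane} (hC : Bornology.IsBounded C) {V : Set Plane}
    (hV : V ⊆ hullVertices C) (hne : V.Nonempty) (hnext : ∀ v ∈ V, ∃ w ∈ V, IsNext C v w)
    (hprev : ∀ w ∈ V, ∃ v ∈ V, IsNext C v w) {z : Plane} (hz : z ∈ hullVertices C) : z ∈ V := by
  obtain ⟨f, hf⟩ := exists_functional hC hz
  obtain ⟨o, ho, hmin⟩ := Set.exists_min_image V f
    (((finite_inter_lattice hC).subset (hullVertices_subset C)).subset hV) hne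
  by_contra hzV
  have hzo : z ≠ o := fun h => hzV (h ▸ ho)
  obtain ⟨q, hq, hoq⟩ := hnext o ho
  obtain ⟨p, hp, hpo⟩ := hprev o ho
  have hlt := hf o (hullVertices_subset C (hV ho)) hzo.symm
  have hqo : q ≠ o := fun h => hzo (hoq.single h z hz)
  have hpo' : o ≠ p := fun h => hzV ((hpo.single h z hz) ▸ hp)
  have h1 := hoq.left z hz.1
  have h2 := hpo.left z hz.1
  have h3 := hoq.left p (hV hp).1
  have h4 := hmin q hq
  have h5 := hmin p hp
  rcases eq_or_lt_of_le h3 with h3 | h3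
  · rcases eq_of_cross_eq_zero (hV ho) (hV hq) (hV hp) hqo.symm h3.symm with h | h
    · exact hpo' h.symm
    · subst h
      -- Here successor and predecessor of `o` coincide, so `z` lies weakly on both sides of the
      -- edge and hence on its line.
      rcases eq_of_cross_eq_zero (hV ho) (hV hq) hz hqo.symm (by
        simp only [cross, PiLp.sub_apply] at h1 h2 ⊢
        linarith) with h | h
      · exact hzo h
      · exact hzV (h ▸ hq)
  -- Cramer's rule: `z - o` lies in the cone spanned by the edges from `o` to `q` and `p`. The
  -- functional is nonnegative on both edges because `o` is minimal in `V`, but negative on `z - o`,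
  -- as `z` is the unique minimizer.
  · have e : cross (q - o) (p - o) • (z - o)
        = cross (o - p) (z - p) • (q - o) + cross (q - o) (z - o) • (p - o) := by
      ext i
      fin_cases i <;> simp [cross] <;> ring
    have e' := congrArg f e
    simp only [map_smul, map_add, map_sub, smul_eq_mul] at e'
    nlinarith [mul_nonneg h2 (sub_nonneg.mpr h4), mul_nonneg h1 (sub_nonneg.mpr h5),
      mul_pos h3 (sub_pos.mpr hlt)]

theorem apex_of_mem_hullVertices {C : Set Plane} (hb : Bornology.IsBounded C) (hc : Convex ℝ C)
    {v : ℤ × ℤ} (hv : pt v ∈ hullVertices C) : Apex C v := by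
  obtain ⟨f, hf⟩ := exists_functional hb hv
  refine ⟨fun x y t hxy h0 h1 => ?_, f !₂[1, 0], f !₂[0, 1], fun p hp => ?_⟩
  · have := hc (hullVertices_subset C hv).1 hxy (sub_nonneg.mpr h1) h0 (by ring)
    convert this using 1
    ext i
    fin_cases i <;> simp <;> ring
  · obtain ⟨hp0, hp⟩ := mem_steps.mp hp
    have h1 := hf _ ⟨hp, pt_mem_lattice _⟩ (fun h => hp0 (by simpa using pt_injective h))
    have h2 : pt (v + p) = pt v + ((p.1 : ℝ) • !₂[1, 0] + (p.2 : ℝ) • !₂[0, 1]) := by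
      ext i; fin_cases i <;> simp
    rw [h2, map_add, map_add, map_smul, map_smul] at h1
    simp only [smul_eq_mul] at h1
    linarith

theorem exists_smul_of_det2_eq_zero {g p : ℤ × ℤ} (hg : IsCoprime g.1 g.2) (h : det2 g p = 0) :
    ∃ k : ℤ, p = k • g := by
  obtain ⟨a, b, hab⟩ := hg
  simp only [det2] at h
  refine ⟨a * p.1 + b * p.2, ?_⟩
  ext
  · simp; linear_combination (-p.1) * hab - b * h
  · simp; linear_combination (-p.2) * hab + a * h

/-- All steps lie weakly to the left of `g`, and those on its line are integer multiples of `g`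
because `g` is primitive. For `g = 0` goodness rules out every step, so `v` is the only vertex, and
`T` is irrelevant. -/
theorem isNext_of_good {C : Set Plane} (hb : Bornology.IsBounded C) {v g : ℤ × ℤ}
    (hv : pt v ∈ hullVertices C) (hg : g = 0 ∨ g ∈ steps C v ∧ IsCoprime g.1 g.2)
    (hgood : ∀ p ∈ steps C v, Good g p) {T : ℤ}
    (hT : g ≠ 0 → pt (v + T • g) ∈ C ∧ ∀ k : ℤ, pt (v + k • g) ∈ C → k ≤ T) :
    IsNext C (pt v) (pt (v + T • g)) := by
  have hstep : ∀ x ∈ C ∩ lattice, x = pt v ∨ ∃ p ∈ steps C v, x = pt (v + p) := by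
    rintro x ⟨hx, hxl⟩
    obtain ⟨q, rfl⟩ := mem_lattice.mp hxl
    by_cases h : q = v
    · exact .inl (by rw [h])
    · exact .inr ⟨q - v, mem_steps.mpr ⟨sub_ne_zero.mpr h, by simpa using hx⟩, by simp⟩
  rcases eq_or_ne g 0 with rfl | hg0
  · simp only [smul_zero, add_zero]
    refine ⟨hv, fun z _ => by simp [cross], fun _ x hx => ?_⟩
    rcases hstep x (hullVertices_subset C hx) with h | ⟨p, hp, -⟩
    · exact h
    · exact absurd rfl (hgood p hp).1
  obtain ⟨hgs, hcop⟩ := hg.resolve_left hg0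
  obtain ⟨hTC, hTmax⟩ := hT hg0
  have hT1 : 1 ≤ T := hTmax 1 (by simpa using (mem_steps.mp hgs).2)
  obtain ⟨f, hf⟩ := exists_functional hb hv
  have hfadd : ∀ p : ℤ × ℤ, f (pt (v + p)) = f (pt v) + f (pt p) := by
    intro p
    rw [← map_add]
    congr 1
    ext i; fin_cases i <;> simp
  have hfsmul : ∀ k : ℤ, f (pt (k • g)) = k * f (pt g) := by
    intro k
    rw [← smul_eq_mul, ← map_smul]
    congr 1
    ext i; fin_cases i <;> simp
  have hfg : 0 < f (pt g) := by
    have := hf _ ⟨(mem_steps.mp hgs).2, pt_mem_lattice _⟩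
      (fun h => hg0 (by simpa using pt_injective h))
    rw [hfadd] at this
    linarith
  have hcross : ∀ p : ℤ × ℤ, cross (pt (v + T • g) - pt v) (pt (v + p) - pt v)
      = T * (det2 g p : ℤ) := by
    intro p
    simp [cross, det2]; ring
  have hTpos : (0 : ℝ) < T := by exact_mod_cast (by omega : 0 < T)
  refine ⟨?_, cross_nonneg_of_lattice fun z hz => ?_, fun h => ?_⟩
  · obtain ⟨M, hM⟩ := ((finite_inter_lattice hb).image f).bddAbove
    let ψ : Plane →L[ℝ] ℝ := (g.1 : ℝ) • EuclideanSpace.proj (1 : Fin 2)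
      - (g.2 : ℝ) • EuclideanSpace.proj (0 : Fin 2)
    have hψ : ∀ p : ℤ × ℤ, ψ (pt (v + p)) = ψ (pt v) + (det2 g p : ℤ) := by
      intro p
      simp [ψ, det2]; ring
    have hw : pt (v + T • g) ∈ C ∩ lattice := ⟨hTC, pt_mem_lattice _⟩
    have hMw := hM ⟨_, hw, rfl⟩
    have hψw : ψ (pt (v + T • g)) = ψ (pt v) := by
      rw [hψ]; simp [det2]; ring
    have hfw := hfadd (T • g)
    rw [hfsmul] at hfw
    -- `ψ` vanishes along `g` and gains at least 1 at lattice points strictly left of it, where the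
    -- factor outweighs any gain `M - f(w)` of `f`. On the line itself `f` increases strictly along
    -- `g`, so the last point wins.
    refine mem_hullVertices_of_unique_max hw (f - (M - f (pt (v + T • g)) + 1) • ψ) ?_
    intro x hx hxw
    simp only [sub_apply, smul_apply, smul_eq_mul]
    rw [hψw]
    rcases hstep x hx with rfl | ⟨p, hp, rfl⟩
    · nlinarith
    · rcases eq_or_lt_of_le (hgood p hp).2 with h0 | h0
      · obtain ⟨k, rfl⟩ := exists_smul_of_det2_eq_zero hcop h0.symm
        have hk : k ≤ T := hTmax k (mem_steps.mp hp).2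
        have hk' : k < T := lt_of_le_of_ne hk (by rintro rfl; exact hxw rfl)
        have hk'' : (k : ℝ) < T := by exact_mod_cast hk'
        rw [hψ, ← h0, hfadd, hfsmul, hfw]
        push_cast
        nlinarith
      · have h1 : (1 : ℝ) ≤ (det2 g p : ℤ) := by exact_mod_cast h0
        have hMx := hM ⟨_, hx, rfl⟩
        rw [hψ]
        nlinarith
  · rcases hstep z hz with rfl | ⟨p, hp, rfl⟩
    · simp [cross]
    · rw [hcross]
      have := (hgood p hp).2
      positivity
  · exfalso
    have h1 : T • g = 0 := add_eq_left.mp (pt_injective h)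
    exact (smul_eq_zero.mp h1).elim (by omega) hg0

/-! ### The program -/

/-- Move to the last lattice point of `C` in the direction in registers 4, 5, and clear register
19 if this is the first vertex. -/
def advance : Program 24 :=
  .seq (.assign 20 (reg 0))
  (.seq (.assign 21 (reg 1))
  (.seq (.assign 22 (reg 4))
  (.seq (.assign 23 (reg 5))
  (.seq lineQuery
  (.seq (.assign 0 (.add (reg 0) (.mul (.floor (reg 16)) (reg 4))))
  (.seq (.assign 1 (.add (reg 1) (.mul (.floor (reg 16)) (reg 5))))
  (.cond (.eq (reg 0) (reg 2))
    (.cond (.eq (reg 1) (reg 3)) (.assign 19 (.const 0)) .skip) .skip)))))))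

/-- The registers hold the vertex `v`, the first vertex `u`, and whether to continue. -/
structure AtVertex (s : Store 24) (u v : Plane) (r : ℝ) : Prop where
  r0 : s 0 = v 0
  r1 : s 1 = v 1
  r2 : s 2 = u 0
  r3 : s 3 = u 1
  r19 : s 19 = r

open Classical in
theorem advance_yields {C : Set Plane} {O : LineOracle} (hO : O.Answers C)
    (hb : Bornology.IsBounded C) {v g : ℤ × ℤ} {u : Plane} (hv : pt v ∈ hullVertices C)
    {s : Store 24} (hs : AtVertex s u (pt v) 1) (hg : Best C v s g)
    (hgood : ∀ p ∈ steps C v, Good g p) :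
    Yields O advance s fun s' => ∃ w, IsNext C (pt v) w ∧
      AtVertex s' u w (if w = u then 0 else 1) := by
  refine .seq (.assign (.seq (.assign (.seq (.assign (.seq (.assign
    (.seq ((lineQuery_yields hO _).mono ?_)))))))))
  rintro s₁ ⟨hfr, hans⟩
  have f0 := hfr 0 (by decide)
  have f1 := hfr 1 (by decide)
  have f2 := hfr 2 (by decide)
  have f3 := hfr 3 (by decide)
  have f4 := hfr 4 (by decide)
  have f5 := hfr 5 (by decide)
  have f19 := hfr 19 (by decide)
  simp [ArithTerm.eval, hs.r0, hs.r1, hs.r2, hs.r3, hs.r19, hg.r4, hg.r5]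
    at f0 f1 f2 f3 f4 f5 f19 hans
  clear hfr
  -- If `g = 0`, this number comes from an arbitrary answer, but it only multiplies the zero vector
  -- and the position does not change.
  obtain ⟨T, hTdef⟩ : ∃ T : ℤ, T = ⌊s₁ 16⌋ := ⟨_, rfl⟩
  have hT : g ≠ 0 → pt (v + T • g) ∈ C ∧ ∀ k : ℤ, pt (v + k • g) ∈ C → k ≤ T := by
    intro hg0
    have hline : ∀ k : ℤ, pt (v + k • g)
        = !₂[(v.1 : ℝ) + (k : ℝ) * g.1, (v.2 : ℝ) + (k : ℝ) * g.2] := by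
      intro k; rw [pt_add]; simp
    have hvC : pt v ∈ C := (hullVertices_subset C hv).1
    rcases hans (by
      by_contra hcon
      push Not at hcon
      exact hg0 (Prod.ext hcon.1 hcon.2)) with ⟨-, h⟩ | ⟨-, -, h⟩
    · exact absurd hvC (by simpa [pt] using h 0)
    · have h0 : s₁ 15 ≤ 0 ∧ 0 ≤ s₁ 16 := (h 0).mp (by simpa [pt] using hvC)
      have hT0 : (0 : ℝ) ≤ T := by
        rw [hTdef]; exact_mod_cast Int.floor_nonneg.mpr h0.2
      refine ⟨?_, fun k hk => ?_⟩
      · rw [hline, h]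
        exact ⟨h0.1.trans hT0, by rw [hTdef]; exact Int.floor_le _⟩
      · rw [hline, h] at hk
        rw [hTdef]
        exact Int.le_floor.mpr hk.2
  have hnext := isNext_of_good hb hv hg.valid hgood hT
  refine .seq (.assign (.seq (.assign ?_)))
  generalize hs2 : Function.update (β := fun _ : Fin 24 => ℝ) _ 1 _ = s₂
  have g0 : s₂ 0 = pt (v + T • g) 0 := by
    subst hs2; simp [ArithTerm.eval, f0, f4, hTdef]
  have g1 : s₂ 1 = pt (v + T • g) 1 := by
    subst hs2; simp [ArithTerm.eval, f1, f5, hTdef]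
  have g2 : s₂ 2 = u 0 := by subst hs2; simp [f2]
  have g3 : s₂ 3 = u 1 := by subst hs2; simp [f3]
  have g19 : s₂ 19 = 1 := by subst hs2; simp [f19]
  clear hs2
  refine .cond (fun h0 => .cond (fun h1 => .assign ?_) (fun h1 => .skip ?_)) (fun h0 => .skip ?_)
  all_goals refine ⟨_, hnext, ?_⟩
  · simp only [Test.Holds, ArithTerm.eval, g0, g1, g2, g3] at h0 h1
    rw [if_pos (by ext i; fin_cases i; exacts [h0, h1])]
    constructor <;> simp [ArithTerm.eval, g0, g1, g2, g3]
  · simp only [Test.Holds, ArithTerm.eval, g1, g3] at h1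
    rw [if_neg (by rintro rfl; exact h1 rfl)]
    exact ⟨g0, g1, g2, g3, g19⟩
  · simp only [Test.Holds, ArithTerm.eval, g0, g2] at h0
    rw [if_neg (by rintro rfl; exact h0 rfl)]
    exact ⟨g0, g1, g2, g3, g19⟩

/-- Output the current vertex and move to the next one. -/
def visit : Program 24 := .seq (.write (reg 0) (reg 1)) (.seq search advance)

/-- A bound for the time of `visit`. -/
def visitTime (j : ℕ) : ℕ := 3 + (4 * searchTime j + 4 + advance.bound)

/-- The program that lists the vertices of a discrete hull. -/
def hullProgram : Program 24 :=
  .seq (.seq (.assign 2 (reg 0)) (.seq (.assign 3 (reg 1)) (.assign 19 (.const 1))))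
    (.loop (.eq (reg 19) (.const 1)) visit)

open Classical in
theorem exec_visit {C : Set Plane} {O : LineOracle} (hO : O.Answers C)
    (hb : Bornology.IsBounded C) (hc : Convex ℝ C) {j : ℕ} (hj : Metric.diam C < 2 ^ j)
    {u v : Plane} (hv : v ∈ hullVertices C) {s : Store 24} (hs : AtVertex s u v 1) :
    ∃ s' n w, Exec O visit s s' [v] n ∧ n ≤ visitTime j ∧ IsNext C v w ∧
      AtVertex s' u w (if w = u then 0 else 1) := by
  obtain ⟨v, rfl⟩ := mem_lattice.mp (hullVertices_subset C hv).2
  have hvC := (hullVertices_subset C hv).1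
  have hδ : ∀ x y : ℝ, !₂[(v.1 : ℝ) + x, (v.2 : ℝ) + y] ∈ C →
      |x| ≤ Metric.diam C ∧ |y| ≤ Metric.diam C := by
    intro x y hxy
    exact ⟨by simpa using abs_coord_sub_le_diam hb hxy hvC 0,
      by simpa using abs_coord_sub_le_diam hb hxy hvC 1⟩
  obtain ⟨s', n, he, hn, w, hw, hs'⟩ : Reaches O (.seq search advance) s _ _ :=
    Reaches.seq ((search_reaches hO (apex_of_mem_hullVertices hb hc hv) hδ hj hs.r0 hs.r1).mono
      le_rfl fun s₁ ⟨hf, g, hg, hgood⟩ => advance_yields hO hb (u := u) hv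
        ⟨hf.1.trans hs.r0, hf.2.1.trans hs.r1, hf.2.2.1.trans hs.r2, hf.2.2.2.1.trans hs.r3,
          hf.2.2.2.2.trans hs.r19⟩ hg hgood)
  refine ⟨s', 3 + n, w, ?_, by simp only [visitTime]; omega, hw, hs'⟩
  have hwrite := Exec.seq (Exec.write (O := O) s (reg 0) (reg 1)) he
  have hout : (!₂[(reg 0).eval s, (reg 1).eval s] : Plane) = pt v := by
    ext i; fin_cases i <;> simp [ArithTerm.eval, hs.r0, hs.r1]
  rw [hout] at hwrite
  exact hwrite

/-- The geometric existence of a successor is read off from a correct run of `visit`. -/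
theorem exists_isNext {C : Set Plane} {O : LineOracle} (hO : O.Answers C)
    (hb : Bornology.IsBounded C) (hc : Convex ℝ C) {v : Plane} (hv : v ∈ hullVertices C) :
    ∃ w, IsNext C v w := by
  obtain ⟨j, hj⟩ := pow_unbounded_of_one_lt (Metric.diam C) (one_lt_two)
  let s : Store 24 := fun i => if i = 0 then v 0 else if i = 1 then v 1 else
    if i = 2 then v 0 else if i = 3 then v 1 else 1
  obtain ⟨-, -, w, -, -, hw, -⟩ := exec_visit hO hb hc hj hv (s := s) (u := v)
    (by constructor <;> simp [s])
  exact ⟨w, hw⟩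

/-- The hull boundary is a cycle of successive vertices. -/
theorem exists_cycle {C : Set Plane} {O : LineOracle} (hO : O.Answers C)
    (hb : Bornology.IsBounded C) (hc : Convex ℝ C) {v₀ : Plane} (hv₀ : v₀ ∈ hullVertices C) :
    ∃ (m : ℕ) (V : ℕ → Plane), 0 < m ∧ V 0 = v₀ ∧ V m = v₀ ∧ (∀ i, 0 < i → i < m → V i ≠ v₀) ∧
      (∀ i, V i ∈ hullVertices C) ∧ (∀ i, IsNext C (V i) (V (i + 1))) ∧
      ((List.range m).map V).Nodup ∧ ∀ x, x ∈ (List.range m).map V ↔ x ∈ hullVertices C := by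
  have hfin : (hullVertices C).Finite := (finite_inter_lattice hb).subset (hullVertices_subset C)
  have : Finite (hullVertices C) := hfin
  choose N hN using fun v : hullVertices C => exists_isNext hO hb hc v.2
  let F : hullVertices C → hullVertices C := fun v => ⟨N v, (hN v).mem⟩
  have hF : Function.Injective F := by
    intro v w h
    have h' : N v = N w := congrArg Subtype.val h
    exact Subtype.ext (IsNext.injective v.2 w.2 (hN v) (h' ▸ hN w))
  let x₀ : hullVertices C := ⟨v₀, hv₀⟩
  have hper : x₀ ∈ Function.periodicPts F := hF.mem_periodicPts x₀
  set m := Function.minimalPeriod F x₀ with hm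
  have hm0 : 0 < m := Function.minimalPeriod_pos_of_mem_periodicPts hper
  have hFm : F^[m] x₀ = x₀ := Function.iterate_minimalPeriod
  have hnext : ∀ i, IsNext C (F^[i] x₀ : hullVertices C) (F^[i + 1] x₀ : hullVertices C) := by
    intro i
    rw [Function.iterate_succ_apply']
    exact hN _
  refine ⟨m, fun i => (F^[i] x₀ : hullVertices C), hm0, rfl, congrArg Subtype.val hFm, ?_,
    fun i => (F^[i] x₀).2, hnext, ?_, fun x => ⟨?_, fun hx => ?_⟩⟩
  · intro i hi him h
    exact absurd (Function.IsPeriodicPt.minimalPeriod_le hi (Subtype.ext h : F^[i] x₀ = x₀))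
      (not_le.mpr him)
  · refine List.Nodup.map_on ?_ List.nodup_range
    intro a ha b hb h
    exact Function.iterate_injOn_Iio_minimalPeriod (List.mem_range.mp ha) (List.mem_range.mp hb)
      (Subtype.ext h)
  · intro hx
    obtain ⟨i, -, rfl⟩ := List.mem_map.mp hx
    exact (F^[i] x₀).2
  · obtain ⟨i, rfl⟩ : x ∈ Set.range fun i => ((F^[i] x₀ : hullVertices C) : Plane) := by
      refine mem_of_closed_under_next hb ?_ (Set.range_nonempty _) ?_ ?_ hx
      · rintro _ ⟨i, rfl⟩; exact (F^[i] x₀).2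
      · rintro _ ⟨i, rfl⟩; exact ⟨_, ⟨i + 1, rfl⟩, hnext i⟩
      · rintro _ ⟨i, rfl⟩
        -- Going `m - 1` steps forward around the cycle is one step back.
        refine ⟨_, ⟨i + (m - 1), rfl⟩, ?_⟩
        have h := hnext (i + (m - 1))
        rwa [show i + (m - 1) + 1 = i + m by omega, Function.iterate_add_apply F i m, hFm] at h
    refine List.mem_map.mpr ⟨i % m, List.mem_range.mpr (Nat.mod_lt _ hm0), ?_⟩
    exact congrArg Subtype.val (Function.iterate_mod_minimalPeriod_eq)

theorem exec_hull_loop {C : Set Plane} {O : LineOracle} (hO : O.Answers C)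
    (hb : Bornology.IsBounded C) (hc : Convex ℝ C) {j : ℕ} (hj : Metric.diam C < 2 ^ j)
    {v₀ : Plane} {m : ℕ} {V : ℕ → Plane} (hVm : V m = v₀)
    (hV0 : ∀ i, 0 < i → i < m → V i ≠ v₀) (hV : ∀ i, V i ∈ hullVertices C)
    (hnext : ∀ i, IsNext C (V i) (V (i + 1))) (k : ℕ) :
    ∀ {s : Store 24} {i : ℕ}, i + (k + 1) = m → AtVertex s v₀ (V i) 1 →
      ∃ s' n, Exec O (.loop (.eq (reg 19) (.const 1)) visit) s s'
        ((List.range' i (k + 1)).map V) n ∧ n ≤ (k + 1) * (visitTime j + 3) + 3 := by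
  have hcost : (Test.eq (reg 19) (.const 1)).cost = 3 := rfl
  induction k with
  | zero =>
    intro s i hi hs
    obtain ⟨s', n, w, he, hn, hw, hs'⟩ := exec_visit hO hb hc hj (hV i) hs
    obtain rfl := (hnext i).unique (hV i) hw
    rw [show i + 1 = m by omega, hVm, if_pos rfl] at hs'
    have hexit := Exec.loopStop (O := O) (P := visit) (b := .eq (reg 19) (.const 1)) (s := s')
      (by simp [Test.Holds, ArithTerm.eval, hs'.r19])
    have hstep := Exec.loopStep (b := .eq (reg 19) (.const 1))
      (by simp [Test.Holds, ArithTerm.eval, hs.r19]) he hexit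
    refine ⟨s', _, by simpa using hstep, ?_⟩
    rw [hcost]; omega
  | succ k ih =>
    intro s i hi hs
    obtain ⟨s', n, w, he, hn, hw, hs'⟩ := exec_visit hO hb hc hj (hV i) hs
    obtain rfl := (hnext i).unique (hV i) hw
    rw [if_neg (hV0 (i + 1) (by omega) (by omega))] at hs'
    obtain ⟨s'', n', he', hn'⟩ := ih (i := i + 1) (by omega) hs'
    have hstep := Exec.loopStep (b := .eq (reg 19) (.const 1))
      (by simp [Test.Holds, ArithTerm.eval, hs.r19]) he he'
    refine ⟨s'', _, by simpa [List.range'_succ] using hstep, ?_⟩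
    rw [hcost]
    have : (k + 1 + 1) * (visitTime j + 3) = (k + 1) * (visitTime j + 3) + (visitTime j + 3) := by
      ring
    omega

theorem exec_hullProgram {C : Set Plane} {O : LineOracle} (hO : O.Answers C)
    (hb : Bornology.IsBounded C) (hc : Convex ℝ C) {j : ℕ} (hj : Metric.diam C < 2 ^ j)
    {v₀ : Plane} (hv₀ : v₀ ∈ hullVertices C) :
    ∃ s l n, Exec O hullProgram (inputStore 24 v₀) s l n ∧ IsHullBoundaryFrom C v₀ l ∧
      n ≤ (hullVertices C).ncard * (visitTime j + 3) + 9 := by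
  obtain ⟨m, V, hm, hV0, hVm, hVne, hV, hnext, hnodup, hmem⟩ := exists_cycle hO hb hc hv₀
  obtain ⟨k, rfl⟩ : ∃ k, m = k + 1 := ⟨m - 1, by omega⟩
  obtain ⟨s₁, n₁, he₁, hn₁, hs₁⟩ : Yields O (.seq (.assign 2 (reg 0))
      (.seq (.assign 3 (reg 1)) (.assign 19 (.const 1)))) (inputStore 24 v₀)
      fun s => AtVertex s v₀ (V 0) 1 := by
    refine .seq (.assign (.seq (.assign (.assign ?_))))
    rw [hV0]
    constructor <;> simp [ArithTerm.eval, inputStore]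
  obtain ⟨s, n, he, hn⟩ := exec_hull_loop hO hb hc hj hVm hVne hV hnext k (by omega) hs₁
  rw [← List.range_eq_range'] at he
  have hcard : (hullVertices C).ncard = k + 1 := by
    have : hullVertices C = (((List.range (k + 1)).map V).toFinset : Set Plane) := by
      classical
      ext x; rw [← hmem]; simp
    classical
    rw [this, Set.ncard_coe_finset, List.toFinset_card_of_nodup hnodup]
    simp
  have hn₁' : n₁ ≤ 6 := hn₁
  refine ⟨s, (List.range (k + 1)).map V, n₁ + n, Exec.seq he₁ he, ⟨?_, hnodup, hmem, ?_⟩, ?_⟩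
  · simp [List.range_succ_eq_map, hV0]
  -- Since `V (k + 1) = v₀`, the closing edge is one more successor edge.
  · have hl : (List.range (k + 1)).map V ++ [v₀] = (List.range (k + 1).succ).map V := by
      rw [List.range_succ (n := k + 1)]; simp [hVm]
    rw [hl, List.isChain_map, List.isChain_range_succ]
    exact fun i _ => (hnext i).left
  · rw [hcard]; omega

/-! ### The absolute constant. -/

theorem exists_pow_gt {δ : ℝ} (hδ : 0 ≤ δ) :
    ∃ j : ℕ, δ < 2 ^ j ∧ (j : ℝ) ≤ 4 * Real.log (2 + δ) ∧ 1 ≤ 2 * Real.log (2 + δ) := by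
  have hlog2 : (1 / 2 : ℝ) < Real.log 2 := by linarith [Real.log_two_gt_d9]
  have hlog : Real.log 2 ≤ Real.log (2 + δ) := Real.log_le_log two_pos (by linarith)
  -- As `log 2 > 1/2`, this `j` is at most `2 L + 1` with `L = log (2 + δ)`, and the 1 is absorbed
  -- by `1 ≤ 2 L`.
  refine ⟨⌊Real.log (2 + δ) / Real.log 2⌋₊ + 1, ?_, ?_, by linarith⟩
  · have h := Nat.lt_floor_add_one (Real.log (2 + δ) / Real.log 2)
    rw [div_lt_iff₀ (by linarith)] at h
    have h2 : Real.log (2 + δ) < Real.log (2 ^ (⌊Real.log (2 + δ) / Real.log 2⌋₊ + 1)) := by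
      rw [Real.log_pow]; exact_mod_cast h
    have := (Real.log_lt_log_iff (by linarith) (by positivity)).mp h2
    linarith
  · have h := Nat.floor_le (a := Real.log (2 + δ) / Real.log 2) (by
      apply div_nonneg <;> linarith)
    have h2 : Real.log (2 + δ) / Real.log 2 ≤ 2 * Real.log (2 + δ) := by
      rw [div_le_iff₀ (by linarith)]; nlinarith
    push_cast
    linarith

end DiscreteHull

open DiscreteHull in
theorem mainTheorem3 :
    ∃ (R : ℕ) (P : Program R) (K : ℝ),
      ∀ (C : Set Plane), IsCompact C → Convex ℝ C →
      ∀ (O : LineOracle), O.Answers C →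
      ∀ v₀ ∈ hullVertices C,
        ∃ (s : Store R) (l : List Plane) (n : ℕ),
          Exec O P (inputStore R v₀) s l n ∧
          IsHullBoundaryFrom C v₀ l ∧
          (n : ℝ) ≤ K * (hullVertices C).ncard * Real.log (2 + Metric.diam C) := by
  refine ⟨24, hullProgram, 24 * (narrow.bound + 3) + 2 * (advance.bound + 71), ?_⟩
  intro C hC hc O hO v₀ hv₀
  obtain ⟨j, hj, hjlog, hlog⟩ := exists_pow_gt (Metric.diam_nonneg (s := C))
  obtain ⟨s, l, n, he, hl, hn⟩ := exec_hullProgram hO hC.isBounded hc hj hv₀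
  refine ⟨s, l, n, he, hl, ?_⟩
  have hcard : 1 ≤ (hullVertices C).ncard :=
    (Set.ncard_pos ((finite_inter_lattice hC.isBounded).subset (hullVertices_subset C))).mpr
      ⟨v₀, hv₀⟩
  set L := Real.log (2 + Metric.diam C)
  set M := (hullVertices C).ncard
  have h1 : n ≤ M * (4 * (j + 1) * (narrow.bound + 3) + (advance.bound + 71)) := by
    -- The 9 steps spent once, 6 for initialization and 3 for the final loop test, are charged to
    -- the at least one vertex.
    have h0 : ∀ t : ℕ, M * (t + 3) + 9 ≤ M * (t + 12) := fun t => by linarith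
    refine (hn.trans (h0 _)).trans_eq ?_
    have e : visitTime j + 12 = 4 * (j + 1) * (narrow.bound + 3) + (advance.bound + 71) := by
      simp only [visitTime, searchTime]; ring
    rw [← e]
  have h2 : (n : ℝ) ≤ M * (4 * (j + 1) * (narrow.bound + 3) + (advance.bound + 71)) := by
    exact_mod_cast h1
  refine h2.trans ?_
  generalize narrow.bound = a
  generalize advance.bound = b
  have h3 : (4 * ((j : ℝ) + 1) * (a + 3) + (b + 71))
      ≤ (24 * (a + 3) + 2 * (b + 71)) * L := by
    -- From `j ≤ 4 L` and `1 ≤ 2 L`.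
    have h4 : (4 * ((j : ℝ) + 1)) ≤ 24 * L := by linarith
    have h5 := mul_le_mul_of_nonneg_right h4 (by positivity : (0 : ℝ) ≤ a + 3)
    have h6 := mul_le_mul_of_nonneg_right hlog (by positivity : (0 : ℝ) ≤ b + 71)
    linarith
  calc (M : ℝ) * (4 * ((j : ℝ) + 1) * (a + 3) + (b + 71))
      ≤ M * ((24 * (a + 3) + 2 * (b + 71)) * L) := by gcongr
    _ = _ := by ring
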